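/- Let $W:\mathbb R\to\mathbb R$ be continuous and even with $W(0)=0$, differentiable on $(0,\infty)$ with $W'>0$ there, and suppose that for some $\alpha\ge\beta>0$, $c_\alpha,C_\beta>0$, $$\lambda(x):=c_\alpha(1+|x|)^{-\alpha}\le W'(x)\le C_\beta(1+|x|)^{-\beta}\qquad\text{for all }x>0 .$$ Let $m\ge 2$ and, for a density $\rho$ on $\mathbb R$, let $$E[\rho]=\frac1{m-1}\int\rho(x)^m\,dx+\frac12\int\!\!\int W(x-y)\rho(y)\rho(x)\,dy\,dx .$$ A radially-decreasing distribution is an integrable function $\rho:\mathbb R\to[0,\infty)$ with $\int\rho=1$ that is even and nonincreasing on $[0,\infty)$. For such $\rho$ that is compactly supported, define $h[\rho]:[0,1]\to[0,\infty)$ by taking $h[\rho](s)$ to be the (least) $h\ge0$ with $\int\min\{\rho(x),h\}\,dx=s$. Let $\rho_0,\rho_1$ be radially-decreasing distributions supported on $[-R,R]$, put $h_i=h[\rho_i]$ and, for $0\le t\le1$, $h_t=(1-t)h_0+t\,h_1$. The $h(s)$-linear curve $\rho_t$ is the radially-decreasing distribution with $h(s)$-representation $h_t$, that is, $$\rho_t(x)=h_t\big(\sup\{s\in(0,1):x\in\mathcal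 C_t(s)\}\big),\qquad \mathcal C_t(s)=\Big[-\frac1{2h_t'(s)},\frac1{2h_t'(s)}\Big],$$ where $'$ on $h$ denotes the derivative in $s$ (which exists for all but countably many $s\in(0,1)$; the other $s$ are disregarded), and $\sup\emptyset=0$; let $\partial_th'=h_1'-h_0'$. Then $t\mapsto E[\rho_t]$ is continuous on $[0,1]$ and twice differentiable on $(0,1)$, and for every $t\in(0,1)$ the integral below is finite and $$\frac{d^2}{dt^2}E[\rho_t]\ \ge\ \frac1{32}\cdot\frac{\lambda(2R)}{R}\int_0^1\frac{(\partial_th'(s))^2}{(h_t'(s))^4}\,ds .$$ -/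

import Mathlib

open MeasureTheory Set Filter Topology

noncomputable section

namespace AggDiff

/-- `ρ` is a radially-decreasing density distribution (non-negative, total mass one, a
nonincreasing function of `|x|` on `[0, ∞)`) that is supported on `[-R, R]`. -/
structure IsRadDecDensity (R : ℝ) (ρ : ℝ → ℝ) : Prop where
  nonneg : ∀ x, 0 ≤ ρ x
  integrable : Integrable ρ
  mass : ∫ x, ρ x = 1
  symm : ∀ x, ρ (-x) = ρ x
  anti : AntitoneOn ρ (Ici 0)
  supp : Function.support ρ ⊆ Icc (-R) R

/-- The profile `r ↦ c (1 + |r|)^(-a)` that bounds `W'` from below and from above. -/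
def powerProfile (c a r : ℝ) : ℝ := c * (1 + |r|) ^ (-a)

/-- Attractive interaction potential whose derivative on `(0, ∞)` lies between
`cα (1 + |x|)^(-α)` and `Cβ (1 + |x|)^(-β)`.  Differentiability on `(0, ∞)` is part of
`deriv_pos`, because `deriv W x = 0` where `W` is not differentiable. -/
structure IsAttractivePotential (α β cα Cβ : ℝ) (W : ℝ → ℝ) : Prop where
  continuous : Continuous W
  zero : W 0 = 0
  symm : ∀ x, W x = W (-x)
  deriv_pos : ∀ x, 0 < x → 0 < deriv W x
  beta_pos : 0 < β
  beta_le : β ≤ α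
  lower_pos : 0 < cα
  upper_pos : 0 < Cβ
  lower : ∀ x, 0 < x → powerProfile cα α x ≤ deriv W x
  upper : ∀ x, 0 < x → deriv W x ≤ powerProfile Cβ β x

/-- The internal energy `𝒮[ρ] = (m - 1)⁻¹ ∫ ρ^m`. -/
def internalEnergy (m : ℝ) (ρ : ℝ → ℝ) : ℝ := 1 / (m - 1) * ∫ x, ρ x ^ m

/-- The interaction energy `ℐ[ρ] = ½ ∫∫ W(x - y) ρ(y) ρ(x) dy dx`. -/
def interactionEnergy (W ρ : ℝ → ℝ) : ℝ :=
  1 / 2 * ∫ x, (∫ y, W (x - y) * ρ y) * ρ x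

/-- The total energy `E[ρ] = 𝒮[ρ] + ℐ[ρ]`. -/
def energy (m : ℝ) (W ρ : ℝ → ℝ) : ℝ := internalEnergy m ρ + interactionEnergy W ρ

/-- The height function `h[ρ]`: for `0 ≤ s ≤ 1` the (least) height `h ≥ 0` with
`∫ min {ρ(x), h} dx = s`. -/
def hFun (ρ : ℝ → ℝ) (s : ℝ) : ℝ := sInf {H : ℝ | 0 ≤ H ∧ s ≤ ∫ x, min (ρ x) H}

/-- The defining equation of the height function. -/
theorem integral_min_hFun {ρ : ℝ → ℝ} (hρ : ∀ x, 0 ≤ ρ x) (hi : Integrable ρ)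
    (hm : ∫ x, ρ x = 1) {s : ℝ} (hs0 : 0 ≤ s) (hs1 : s < 1) :
    0 ≤ hFun ρ s ∧ ∫ x, min (ρ x) (hFun ρ s) = s := by
  set F : ℝ → ℝ := fun H => ∫ x, min (ρ x) H with hF
  have hmeas : ∀ H : ℝ, AEStronglyMeasurable (fun x => min (ρ x) H) volume := fun H =>
    hi.aestronglyMeasurable.inf aestronglyMeasurable_const
  have hbd : ∀ H : ℝ, 0 ≤ H → ∀ x, ‖min (ρ x) H‖ ≤ ρ x := fun H hH x => by
    rw [Real.norm_of_nonneg (le_min (hρ x) hH)]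
    exact min_le_left _ _
  have hcont : ContinuousOn F (Ici 0) := by
    refine continuousOn_of_dominated (bound := ρ) (fun H _ => hmeas H)
      (fun H hH => ae_of_all _ (hbd H hH)) hi (ae_of_all _ fun x => ?_)
    fun_prop
  have hF0 : F 0 = 0 := by
    simp [hF, hρ]
  have hlim : Tendsto F atTop (𝓝 1) := by
    rw [← hm]
    refine tendsto_integral_filter_of_dominated_convergence ρ
      (Eventually.of_forall hmeas) ?_ hi (ae_of_all _ fun x => ?_)
    · filter_upwards [eventually_ge_atTop (0 : ℝ)] with H hH
      exact ae_of_all _ (hbd H hH)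
    · refine tendsto_const_nhds.congr' ?_
      filter_upwards [eventually_ge_atTop (ρ x)] with H hH
      exact (min_eq_left hH).symm
  set S : Set ℝ := {H : ℝ | 0 ≤ H ∧ s ≤ F H} with hS
  have hne : S.Nonempty := by
    obtain ⟨H, h1, h2⟩ :=
      ((hlim.eventually (lt_mem_nhds hs1)).and (eventually_ge_atTop (0 : ℝ))).exists
    exact ⟨H, h2, h1.le⟩
  have hbdd : BddBelow S := ⟨0, fun H hH => hH.1⟩
  have hcl : IsClosed S := by
    have h := hcont.preimage_isClosed_of_isClosed isClosed_Ici (isClosed_Ici (a := s))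
    exact h
  have hmem : sInf S ∈ S := hcl.csInf_mem hne hbdd
  obtain ⟨H, hH, hHs⟩ : s ∈ F '' Icc 0 (sInf S) :=
    intermediate_value_Icc hmem.1 (hcont.mono Icc_subset_Ici_self)
      ⟨by rw [hF0]; exact hs0, hmem.2⟩
  have hle : sInf S ≤ H := csInf_le hbdd ⟨hH.1, hHs.ge⟩
  have heq : H = sInf S := le_antisymm hH.2 hle
  rw [heq] at hHs
  exact ⟨hmem.1, hHs⟩

/-- The symmetric interval `𝒞(s) = [-1/(2h'(s)), 1/(2h'(s))]` of length `1/h'(s)`, the super-level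
set at height `h(s)` of the radially-decreasing distribution with `h(s)`-representation `h`. -/
def levelInterval (h : ℝ → ℝ) (s : ℝ) : Set ℝ :=
  Icc (-(1 / (2 * deriv h s))) (1 / (2 * deriv h s))

/-- The radially-decreasing distribution recovered from its `h(s)`-representation:
`ρ(x) = h(sup {s : x ∈ 𝒞(s)})`, the supremum of the empty set being `0`. -/
def ofHFun (h : ℝ → ℝ) (x : ℝ) : ℝ := h (sSup {s | s ∈ Ioo (0 : ℝ) 1 ∧ x ∈ levelInterval h s})

/-- The linear interpolation `h_t = (1 - t) h[ρ₀] + t h[ρ₁]`. -/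
def hLinear (ρ₀ ρ₁ : ℝ → ℝ) (t s : ℝ) : ℝ := (1 - t) * hFun ρ₀ s + t * hFun ρ₁ s

/-- The `h(s)`-linear curve `ρ_t` from `ρ₀` to `ρ₁`. -/
def hLinearCurve (ρ₀ ρ₁ : ℝ → ℝ) (t : ℝ) : ℝ → ℝ := ofHFun (hLinear ρ₀ ρ₁ t)

/-- The energy `t ↦ E[ρ_t]` along the `h(s)`-linear curve. -/
def curveEnergy (m : ℝ) (W ρ₀ ρ₁ : ℝ → ℝ) (t : ℝ) : ℝ := energy m W (hLinearCurve ρ₀ ρ₁ t)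

/-- The integrand `(∂_t h'(s))² / (h_t'(s))⁴`, where `∂_t h' = h₁' - h₀'` does not depend on `t`. -/
def convexityIntegrand (ρ₀ ρ₁ : ℝ → ℝ) (t s : ℝ) : ℝ :=
  (deriv (hFun ρ₁) s - deriv (hFun ρ₀) s) ^ 2 / (deriv (hLinear ρ₀ ρ₁ t) s) ^ 4

end AggDiff

end

/-!
The energy of the `h(s)`-linear curve is computed in height variables, where the curve is a straight
line, and there it is an integral of convex functions of `t`.

*Height variables.* The mass of `ρ` below a height is concave in the height, so its inverse
`h = hFun ρ` is convex on `[0, 1]`, and its slopes are at least `1/(2R)` (`IsHeightProfile`). Both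
properties pass to convex combinations, and so does the right derivative `p = rightSlope h`, which
equals `deriv h` almost everywhere. Since `p` is monotone, `{s : x ∈ 𝒞(s)}` is an initial segment
of `(0, 1)`, and the fundamental theorem of calculus gives the layer-cake formula
`φ(ρ(x)) - φ(0) = ∫₀¹ φ'(h(s)) p(s) 1_{𝒞(s)}(x) ds` (`IsHeightProfile.comp_ofHFun`). By Fubini
`∫ ρ^m = m ∫₀¹ h^(m-1)`, and the interaction energy is half the double integral over `s, r` of
`pairEnergy W (p s) (p r)`, the mean of `W(x - y)` over `x ∈ 𝒞(s)`, `y ∈ 𝒞(r)`.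

*Pair energy.* `W` need not be twice differentiable, but `pairEnergy W p q` is an expression in the
first two primitives of `W`, hence twice differentiable. With `x, y = (1/p ± 1/q)/2` and
`w = 2pq ∫_{|y|}^x r W(r) dr`, its second derivative in the direction `(p', q')` is
`(W x - W y) (q/(2p) (p'/p)² + p/(2q) (q'/q)²) + (W x + W y - 2 w) (p'/p) (q'/q)`.
As `x² - y² = 1/(pq)`, the number `w` is a weighted mean of the increasing function `W` over
`[|y|, x]`, which makes this quadratic form nonnegative. The lower bound `λ(2R)` on the slopes
of `W` keeps `w` away from the two end values and yields the lower bound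
`λ(2R)/(6R) (p'²/p⁴ + q'²/q⁴)` (`HasSlopeBounds.le_pairEnergyD2`).

*Differentiation.* For `t` in a compact subinterval of `(0, 1)` the ratios `∂ₜp/p` and `∂ₜh/h` are
bounded, and `1/p ≤ 2R`, so that the integrands and their first two `t`-derivatives are bounded
and may be differentiated under the integral sign. The internal energy is convex because `m ≥ 2`.
-/

noncomputable section

namespace AggDiff

/-! ### Primitives of the potential and the pair energy -/

/-- The continuous even potential `W` grows on `[0, A]` with slopes between `lam` and `L`. -/
structure HasSlopeBounds (lam L A : ℝ) (W : ℝ → ℝ) : Prop where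
  continuous : Continuous W
  even : ∀ x, W (-x) = W x
  le_sub : ∀ x y, 0 ≤ y → y ≤ x → x ≤ A → lam * (x - y) ≤ W x - W y
  sub_le : ∀ x y, 0 ≤ y → y ≤ x → x ≤ A → W x - W y ≤ L * (x - y)

/-- The primitive `x ↦ ∫₀ˣ W`. -/
def prim (W : ℝ → ℝ) (x : ℝ) : ℝ := ∫ r in (0 : ℝ)..x, W r

/-- The primitive `x ↦ ∫₀ˣ r W(r) dr` of the first moment of `W`. -/
def momentPrim (W : ℝ → ℝ) (x : ℝ) : ℝ := ∫ r in (0 : ℝ)..x, r * W r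

theorem hasDerivAt_prim {W : ℝ → ℝ} (hW : Continuous W) (x : ℝ) :
    HasDerivAt (prim W) (W x) x :=
  intervalIntegral.integral_hasDerivAt_right (hW.intervalIntegrable _ _)
    (hW.stronglyMeasurableAtFilter _ _) hW.continuousAt

theorem hasDerivAt_momentPrim {W : ℝ → ℝ} (hW : Continuous W) (x : ℝ) :
    HasDerivAt (momentPrim W) (x * W x) x :=
  hasDerivAt_prim (W := fun r => r * W r) (by fun_prop) x

theorem continuous_prim {W : ℝ → ℝ} (hW : Continuous W) : Continuous (prim W) :=
  continuous_iff_continuousAt.2 fun x => (hasDerivAt_prim hW x).continuousAt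

theorem continuous_momentPrim {W : ℝ → ℝ} (hW : Continuous W) : Continuous (momentPrim W) :=
  continuous_iff_continuousAt.2 fun x => (hasDerivAt_momentPrim hW x).continuousAt

theorem integral_eq_prim_sub {W : ℝ → ℝ} (hW : Continuous W) (a b : ℝ) :
    ∫ r in a..b, W r = prim W b - prim W a :=
  (intervalIntegral.integral_interval_sub_left (hW.intervalIntegrable _ _)
    (hW.intervalIntegrable _ _)).symm

/-- A second primitive of `W`, namely `x ↦ ∫₀ˣ (x - r) W(r) dr`. -/
def secondPrim (W : ℝ → ℝ) (x : ℝ) : ℝ := x * prim W x - momentPrim W x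

theorem hasDerivAt_secondPrim {W : ℝ → ℝ} (hW : Continuous W) (x : ℝ) :
    HasDerivAt (secondPrim W) (prim W x) x := by
  have := ((hasDerivAt_id x).mul (hasDerivAt_prim hW x)).sub (hasDerivAt_momentPrim hW x)
  exact this.congr_deriv (by simp)

theorem prim_neg {W : ℝ → ℝ} (he : ∀ x, W (-x) = W x) (x : ℝ) :
    prim W (-x) = - prim W x := by
  have h := intervalIntegral.integral_comp_neg (a := 0) (b := x) W
  simp only [he, neg_zero] at h
  rw [prim, prim, h, intervalIntegral.integral_symm]

theorem momentPrim_neg {W : ℝ → ℝ} (he : ∀ x, W (-x) = W x) (x : ℝ) :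
    momentPrim W (-x) = momentPrim W x := by
  have h := intervalIntegral.integral_comp_neg (a := 0) (b := x) (fun r => r * W r)
  simp only [he, neg_zero, neg_mul, intervalIntegral.integral_neg] at h
  rw [momentPrim, momentPrim, intervalIntegral.integral_symm, ← h, neg_neg]

theorem secondPrim_neg {W : ℝ → ℝ} (he : ∀ x, W (-x) = W x) (x : ℝ) :
    secondPrim W (-x) = secondPrim W x := by
  simp [secondPrim, prim_neg he, momentPrim_neg he]

/-- The mean of `W(x - y)` over `|x| ≤ 1/(2p)`, `|y| ≤ 1/(2q)`, written with the primitives of `W`.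
This is the interaction of two centred unit masses spread evenly over intervals of
lengths `1/p` and `1/q`. -/
def pairEnergy (W : ℝ → ℝ) (p q : ℝ) : ℝ :=
  p * (prim W ((1 / p + 1 / q) / 2) + prim W ((1 / p - 1 / q) / 2)) +
    q * (prim W ((1 / p + 1 / q) / 2) - prim W ((1 / p - 1 / q) / 2)) -
    2 * p * q *
      (momentPrim W ((1 / p + 1 / q) / 2) - momentPrim W ((1 / p - 1 / q) / 2))

/-- The first derivative of `pairEnergy W p q` in the direction `(p', q')`. -/
def pairEnergyD (W : ℝ → ℝ) (p q p' q' : ℝ) : ℝ :=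
  (p * (prim W ((1 / p + 1 / q) / 2) + prim W ((1 / p - 1 / q) / 2)) -
    2 * p * q *
      (momentPrim W ((1 / p + 1 / q) / 2) - momentPrim W ((1 / p - 1 / q) / 2))) * (p' / p) +
  (q * (prim W ((1 / p + 1 / q) / 2) - prim W ((1 / p - 1 / q) / 2)) -
    2 * p * q *
      (momentPrim W ((1 / p + 1 / q) / 2) - momentPrim W ((1 / p - 1 / q) / 2))) * (q' / q)

/-- The second derivative of `pairEnergy W p q` in the direction `(p', q')`. -/
def pairEnergyD2 (W : ℝ → ℝ) (p q p' q' : ℝ) : ℝ :=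
  (W ((1 / p + 1 / q) / 2) - W ((1 / p - 1 / q) / 2)) *
    (q / (2 * p) * (p' / p) ^ 2 + p / (2 * q) * (q' / q) ^ 2) +
  (W ((1 / p + 1 / q) / 2) + W ((1 / p - 1 / q) / 2) -
    4 * p * q * (momentPrim W ((1 / p + 1 / q) / 2) - momentPrim W ((1 / p - 1 / q) / 2))) *
    (p' / p * (q' / q))

theorem pairEnergy_eq_secondPrim (W : ℝ → ℝ) {p q : ℝ} (hp : p ≠ 0) (hq : q ≠ 0) :
    pairEnergy W p q =
      2 * p * q * (secondPrim W ((1 / p + 1 / q) / 2) - secondPrim W ((1 / p - 1 / q) / 2)) := by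
  simp only [pairEnergy, secondPrim]
  generalize prim W ((1 / p + 1 / q) / 2) = k
  generalize prim W ((1 / p - 1 / q) / 2) = l
  generalize momentPrim W ((1 / p + 1 / q) / 2) = i
  generalize momentPrim W ((1 / p - 1 / q) / 2) = j
  field_simp
  ring

theorem hasDerivAt_pairEnergy {W : ℝ → ℝ} (hW : Continuous W) {P Q : ℝ → ℝ} {p' q' t : ℝ}
    (hP : HasDerivAt P p' t) (hQ : HasDerivAt Q q' t) (hp : P t ≠ 0) (hq : Q t ≠ 0) :
    HasDerivAt (fun τ => pairEnergy W (P τ) (Q τ)) (pairEnergyD W (P t) (Q t) p' q') t := by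
  have ha : HasDerivAt (fun τ => 1 / P τ) (-p' / P t ^ 2) t := by simpa using hP.fun_inv hp
  have hb : HasDerivAt (fun τ => 1 / Q τ) (-q' / Q t ^ 2) t := by simpa using hQ.fun_inv hq
  have hx := (ha.fun_add hb).div_const 2
  have hy := (ha.fun_sub hb).div_const 2
  have kx := (hasDerivAt_prim hW ((1 / P t + 1 / Q t) / 2)).comp t hx
  have ky := (hasDerivAt_prim hW ((1 / P t - 1 / Q t) / 2)).comp t hy
  have jx := (hasDerivAt_momentPrim hW ((1 / P t + 1 / Q t) / 2)).comp t hx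
  have jy := (hasDerivAt_momentPrim hW ((1 / P t - 1 / Q t) / 2)).comp t hy
  have := ((hP.mul (kx.add ky)).add (hQ.mul (kx.sub ky))).sub
    (((hP.const_mul 2).mul hQ).mul (jx.sub jy))
  refine this.congr_deriv ?_
  simp only [pairEnergyD, Pi.add_apply, Pi.sub_apply, Function.comp_apply, Pi.mul_apply]
  generalize prim W ((1 / P t + 1 / Q t) / 2) = k
  generalize prim W ((1 / P t - 1 / Q t) / 2) = l
  generalize momentPrim W ((1 / P t + 1 / Q t) / 2) = i
  generalize momentPrim W ((1 / P t - 1 / Q t) / 2) = j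
  generalize W ((1 / P t + 1 / Q t) / 2) = u
  generalize W ((1 / P t - 1 / Q t) / 2) = v
  field_simp
  ring

theorem hasDerivAt_pairEnergyD {W : ℝ → ℝ} (hW : Continuous W) {P Q : ℝ → ℝ} {p' q' t : ℝ}
    (hP : HasDerivAt P p' t) (hQ : HasDerivAt Q q' t) (hp : P t ≠ 0) (hq : Q t ≠ 0) :
    HasDerivAt (fun τ => pairEnergyD W (P τ) (Q τ) p' q') (pairEnergyD2 W (P t) (Q t) p' q') t := by
  have ha : HasDerivAt (fun τ => 1 / P τ) (-p' / P t ^ 2) t := by simpa using hP.fun_inv hp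
  have hb : HasDerivAt (fun τ => 1 / Q τ) (-q' / Q t ^ 2) t := by simpa using hQ.fun_inv hq
  have hx := (ha.fun_add hb).div_const 2
  have hy := (ha.fun_sub hb).div_const 2
  have kx := (hasDerivAt_prim hW ((1 / P t + 1 / Q t) / 2)).comp t hx
  have ky := (hasDerivAt_prim hW ((1 / P t - 1 / Q t) / 2)).comp t hy
  have jx := (hasDerivAt_momentPrim hW ((1 / P t + 1 / Q t) / 2)).comp t hx
  have jy := (hasDerivAt_momentPrim hW ((1 / P t - 1 / Q t) / 2)).comp t hy
  have hJ := ((hP.const_mul 2).mul hQ).mul (jx.sub jy)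
  have := (((hP.mul (kx.add ky)).sub hJ).mul ((hasDerivAt_const t p').div hP hp)).add
    (((hQ.mul (kx.sub ky)).sub hJ).mul ((hasDerivAt_const t q').div hQ hq))
  refine this.congr_deriv ?_
  simp only [pairEnergyD2, Pi.add_apply, Pi.sub_apply, Function.comp_apply, Pi.mul_apply,
    Pi.div_apply]
  generalize prim W ((1 / P t + 1 / Q t) / 2) = k
  generalize prim W ((1 / P t - 1 / Q t) / 2) = l
  generalize momentPrim W ((1 / P t + 1 / Q t) / 2) = i
  generalize momentPrim W ((1 / P t - 1 / Q t) / 2) = j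
  generalize W ((1 / P t + 1 / Q t) / 2) = u
  generalize W ((1 / P t - 1 / Q t) / 2) = v
  field_simp
  ring

/-! ### Bounds on the pair energy and its derivatives -/

theorem HasSlopeBounds.mono {lam lam' L A : ℝ} {W : ℝ → ℝ} (h : HasSlopeBounds lam L A W)
    (hl : lam' ≤ lam) : HasSlopeBounds lam' L A W where
  continuous := h.continuous
  even := h.even
  le_sub x y hy hyx hx :=
    (mul_le_mul_of_nonneg_right hl (sub_nonneg.2 hyx)).trans (h.le_sub x y hy hyx hx)
  sub_le := h.sub_le

theorem integral_affine_moment (c lam x y : ℝ) :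
    ∫ r in y..x, r * (c + lam * r) = c * (x ^ 2 - y ^ 2) / 2 + lam * (x ^ 3 - y ^ 3) / 3 := by
  have : ∀ r ∈ uIcc y x,
      HasDerivAt (fun r => c * r ^ 2 / 2 + lam * r ^ 3 / 3) (r * (c + lam * r)) r := fun r _ => by
    have := (((hasDerivAt_pow 2 r).const_mul c).div_const 2).fun_add
      (((hasDerivAt_pow 3 r).const_mul lam).div_const 3)
    exact this.congr_deriv (by push_cast; ring)
  rw [intervalIntegral.integral_eq_sub_of_hasDerivAt this
    (Continuous.intervalIntegrable (by fun_prop) _ _)]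
  ring

theorem HasSlopeBounds.momentPrim_sub_le {lam L A : ℝ} {W : ℝ → ℝ} (h : HasSlopeBounds lam L A W)
    {x y : ℝ} (hy : 0 ≤ y) (hyx : y ≤ x) (hx : x ≤ A) :
    momentPrim W x - momentPrim W y ≤
      (W x - lam * x) * (x ^ 2 - y ^ 2) / 2 + lam * (x ^ 3 - y ^ 3) / 3 := by
  have hc := h.continuous
  rw [← integral_affine_moment, momentPrim, momentPrim,
    intervalIntegral.integral_interval_sub_left (Continuous.intervalIntegrable (by fun_prop) _ _)
      (Continuous.intervalIntegrable (by fun_prop) _ _)]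
  refine intervalIntegral.integral_mono_on hyx (Continuous.intervalIntegrable (by fun_prop) _ _)
    (Continuous.intervalIntegrable (by fun_prop) _ _) fun r hr => ?_
  refine mul_le_mul_of_nonneg_left ?_ (hy.trans hr.1)
  linarith [h.le_sub x r (hy.trans hr.1) hr.2 hx]

theorem HasSlopeBounds.le_momentPrim_sub {lam L A : ℝ} {W : ℝ → ℝ} (h : HasSlopeBounds lam L A W)
    {x y : ℝ} (hy : 0 ≤ y) (hyx : y ≤ x) (hx : x ≤ A) :
    (W y - lam * y) * (x ^ 2 - y ^ 2) / 2 + lam * (x ^ 3 - y ^ 3) / 3 ≤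
      momentPrim W x - momentPrim W y := by
  have hc := h.continuous
  rw [← integral_affine_moment, momentPrim, momentPrim,
    intervalIntegral.integral_interval_sub_left (Continuous.intervalIntegrable (by fun_prop) _ _)
      (Continuous.intervalIntegrable (by fun_prop) _ _)]
  refine intervalIntegral.integral_mono_on hyx (Continuous.intervalIntegrable (by fun_prop) _ _)
    (Continuous.intervalIntegrable (by fun_prop) _ _) fun r hr => ?_
  refine mul_le_mul_of_nonneg_left ?_ (hy.trans hr.1)
  linarith [h.le_sub r y hy hr.1 (hr.2.trans hx)]

/-- Evenness allows `W` and its moment primitive to be evaluated at the absolute value of the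
half-difference, where monotonicity of `W` applies. -/
theorem HasSlopeBounds.apply_abs {lam L A : ℝ} {W : ℝ → ℝ} (h : HasSlopeBounds lam L A W)
    (y : ℝ) : W |y| = W y ∧ momentPrim W |y| = momentPrim W y := by
  rcases abs_choice y with hy | hy <;> rw [hy]
  · exact ⟨rfl, rfl⟩
  · exact ⟨h.even y, momentPrim_neg h.even y⟩

/-- The moment `2pq (J(x) - J(y))` at `x, y = (1/p ± 1/q)/2` is the mean of `W` over `[|y|, x]`
with weight proportional to `r`, so it is separated from the end values `W |y|` and `W x`. In terms
of `a = 1/p` and `b = 1/q` the interval `[|y|, x]` has length `min a b`. -/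
theorem HasSlopeBounds.pair_moment_bounds {lam L R : ℝ} {W : ℝ → ℝ}
    (h : HasSlopeBounds lam L (2 * R) W) (hl : 0 ≤ lam) {a b : ℝ} (ha : 0 < a) (hb : 0 < b)
    (haR : a ≤ 2 * R) (hbR : b ≤ 2 * R) :
    W ((a - b) / 2) + lam * min a b / 3 ≤
      2 / (a * b) * (momentPrim W ((a + b) / 2) - momentPrim W ((a - b) / 2)) ∧
    2 / (a * b) * (momentPrim W ((a + b) / 2) - momentPrim W ((a - b) / 2)) ≤
      W ((a + b) / 2) - lam * min a b / 3 := by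
  obtain ⟨e1, e2⟩ := h.apply_abs ((a - b) / 2)
  rw [← e1, ← e2]
  have hy : 0 ≤ |(a - b) / 2| := abs_nonneg _
  have hyx : |(a - b) / 2| ≤ (a + b) / 2 := abs_le.2 ⟨by linarith, by linarith⟩
  have hx : (a + b) / 2 ≤ 2 * R := by linarith
  have h1 := h.momentPrim_sub_le hy hyx hx
  have h2 := h.le_momentPrim_sub hy hyx hx
  have hmin : min a b = (a + b) / 2 - |(a - b) / 2| := by
    rcases le_total a b with hab | hab
    · rw [min_eq_left hab, abs_of_nonpos (by linarith)]; ring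
    · rw [min_eq_right hab, abs_of_nonneg (by linarith)]; ring
  have hab : a * b = ((a + b) / 2) ^ 2 - |(a - b) / 2| ^ 2 := by rw [sq_abs]; ring
  rw [hmin, hab]
  have hpos : 0 < ((a + b) / 2) ^ 2 - |(a - b) / 2| ^ 2 := hab ▸ mul_pos ha hb
  generalize |(a - b) / 2| = y at *
  generalize (a + b) / 2 = x at *
  have hx0 : 0 ≤ x := hy.trans hyx
  rw [div_mul_eq_mul_div]
  constructor
  · rw [le_div_iff₀ hpos]
    have : 0 ≤ lam * ((x - y) * (x * (x - y))) :=
      mul_nonneg hl (mul_nonneg (by linarith) (mul_nonneg hx0 (by linarith)))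
    have : 0 ≤ lam * ((x - y) ^ 2 * y) := mul_nonneg hl (by positivity)
    nlinarith
  · rw [div_le_iff₀ hpos]
    have : 0 ≤ lam * ((x - y) ^ 2 * y) := mul_nonneg hl (by positivity)
    nlinarith

theorem HasSlopeBounds.sub_pair_le {lam L R : ℝ} {W : ℝ → ℝ}
    (h : HasSlopeBounds lam L (2 * R) W) {a b : ℝ} (ha : 0 < a) (hb : 0 < b)
    (haR : a ≤ 2 * R) (hbR : b ≤ 2 * R) :
    W ((a + b) / 2) - W ((a - b) / 2) ≤ L * min a b := by
  rw [← (h.apply_abs ((a - b) / 2)).1]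
  refine (h.sub_le _ _ (abs_nonneg _) (abs_le.2 ⟨by linarith, by linarith⟩)
    (by linarith)).trans_eq ?_
  rcases le_total a b with hab | hab
  · rw [min_eq_left hab, abs_of_nonpos (by linarith)]; ring
  · rw [min_eq_right hab, abs_of_nonneg (by linarith)]; ring

/-- Quantitative convexity of the pair energy along straight lines in `(p, q)`. -/
theorem HasSlopeBounds.le_pairEnergyD2 {lam L R : ℝ} {W : ℝ → ℝ}
    (h : HasSlopeBounds lam L (2 * R) W) (hl : 0 ≤ lam) (hR : 0 < R) {p q : ℝ} (p' q' : ℝ)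
    (hp : 0 < p) (hq : 0 < q) (hpR : 1 / p ≤ 2 * R) (hqR : 1 / q ≤ 2 * R) :
    lam / (6 * R) * (p' ^ 2 / p ^ 4 + q' ^ 2 / q ^ 4) ≤ pairEnergyD2 W p q p' q' := by
  obtain ⟨h1, h2⟩ := h.pair_moment_bounds hl (one_div_pos.2 hp) (one_div_pos.2 hq) hpR hqR
  have e1 : p' ^ 2 / p ^ 4 = (1 / p) ^ 2 * (p' / p) ^ 2 := by field_simp
  have e2 : q' ^ 2 / q ^ 4 = (1 / q) ^ 2 * (q' / q) ^ 2 := by field_simp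
  have e3 : q / (2 * p) = (1 / p) / (2 * (1 / q)) := by field_simp
  have e4 : p / (2 * q) = (1 / q) / (2 * (1 / p)) := by field_simp
  have e5 : 4 * p * q = 2 * (2 / (1 / p * (1 / q))) := by field_simp; ring
  rw [pairEnergyD2, e1, e2, e3, e4, e5]
  have ha : 0 < 1 / p := one_div_pos.2 hp
  have hb : 0 < 1 / q := one_div_pos.2 hq
  generalize 1 / p = a at *
  generalize 1 / q = b at *
  generalize p' / p = u
  generalize q' / q = v
  rw [mul_assoc 2 (2 / (a * b))]
  generalize 2 / (a * b) * (momentPrim W ((a + b) / 2) - momentPrim W ((a - b) / 2)) = w at *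
  generalize W ((a + b) / 2) = s at *
  generalize W ((a - b) / 2) = r at *
  have hmin : 0 < min a b := lt_min ha hb
  -- The mixed coefficient is dominated through `2|uv| ≤ (a/b) u² + (b/a) v²`.
  have key : lam * min a b / 3 * (a / b * u ^ 2 + b / a * v ^ 2) ≤
      (s - r) * (a / (2 * b) * u ^ 2 + b / (2 * a) * v ^ 2) + (s + r - 2 * w) * (u * v) := by
    have i1 : 0 ≤ a / b * u ^ 2 + b / a * v ^ 2 - 2 * (u * v) := by
      have : a / b * u ^ 2 + b / a * v ^ 2 - 2 * (u * v) = (a * u - b * v) ^ 2 / (a * b) := by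
        field_simp; ring
      rw [this]; positivity
    have i2 : 0 ≤ a / b * u ^ 2 + b / a * v ^ 2 + 2 * (u * v) := by
      have : a / b * u ^ 2 + b / a * v ^ 2 + 2 * (u * v) = (a * u + b * v) ^ 2 / (a * b) := by
        field_simp; ring
      rw [this]; positivity
    have e : (s - r) * (a / (2 * b) * u ^ 2 + b / (2 * a) * v ^ 2) + (s + r - 2 * w) * (u * v) =
        (s - w) / 2 * (a / b * u ^ 2 + b / a * v ^ 2 + 2 * (u * v)) +
        (w - r) / 2 * (a / b * u ^ 2 + b / a * v ^ 2 - 2 * (u * v)) := by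
      field_simp; ring
    rw [e]
    have j1 := mul_le_mul_of_nonneg_right (show lam * min a b / 3 / 2 ≤ (s - w) / 2 by linarith) i2
    have j2 := mul_le_mul_of_nonneg_right (show lam * min a b / 3 / 2 ≤ (w - r) / 2 by linarith) i1
    linarith
  refine le_trans ?_ key
  have k1 : a ^ 2 / (2 * R) ≤ min a b * (a / b) := by
    rw [mul_div_assoc', div_le_div_iff₀ (by positivity) hb]
    rcases le_total a b with hab | hab
    · rw [min_eq_left hab]; nlinarith [mul_pos ha ha]
    · rw [min_eq_right hab]; nlinarith [mul_pos ha hb]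
  have k2 : b ^ 2 / (2 * R) ≤ min a b * (b / a) := by
    rw [mul_div_assoc', div_le_div_iff₀ (by positivity) ha]
    rcases le_total a b with hab | hab
    · rw [min_eq_left hab]; nlinarith [mul_pos ha hb]
    · rw [min_eq_right hab]; nlinarith [mul_pos hb hb]
  calc lam / (6 * R) * (a ^ 2 * u ^ 2 + b ^ 2 * v ^ 2)
      = lam / 3 * (a ^ 2 / (2 * R) * u ^ 2 + b ^ 2 / (2 * R) * v ^ 2) := by field_simp; ring
    _ ≤ lam / 3 * (min a b * (a / b) * u ^ 2 + min a b * (b / a) * v ^ 2) := by gcongr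
    _ = _ := by ring

theorem abs_prim_sub_le {W : ℝ → ℝ} (hW : Continuous W) {S A x y : ℝ}
    (hS : ∀ z ∈ Icc (-A) A, |W z| ≤ S) (hx : x ∈ Icc (-A) A) (hy : y ∈ Icc (-A) A) :
    |prim W x - prim W y| ≤ S * |x - y| := by
  rw [← integral_eq_prim_sub hW, ← Real.norm_eq_abs]
  refine intervalIntegral.norm_integral_le_of_norm_le_const fun z hz => hS z ?_
  exact (convex_Icc (-A) A).ordConnected.uIcc_subset hy hx (uIoc_subset_uIcc hz)

section bounds

variable {lam L R S p q : ℝ} {W : ℝ → ℝ}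

/-- The three means of `W` out of which the pair energy and its derivatives are built are bounded
by the supremum of `|W|`. -/
theorem HasSlopeBounds.pair_mean_bounds (h : HasSlopeBounds lam L (2 * R) W) (hl : 0 ≤ lam)
    (hS : ∀ z ∈ Icc (-(2 * R)) (2 * R), |W z| ≤ S)
    (hp : 0 < p) (hq : 0 < q) (hpR : 1 / p ≤ 2 * R) (hqR : 1 / q ≤ 2 * R) :
    |p * (prim W ((1 / p + 1 / q) / 2) + prim W ((1 / p - 1 / q) / 2))| ≤ S ∧
    |q * (prim W ((1 / p + 1 / q) / 2) - prim W ((1 / p - 1 / q) / 2))| ≤ S ∧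
    |2 * p * q *
      (momentPrim W ((1 / p + 1 / q) / 2) - momentPrim W ((1 / p - 1 / q) / 2))| ≤ S := by
  have ha : 0 < 1 / p := one_div_pos.2 hp
  have hb : 0 < 1 / q := one_div_pos.2 hq
  have hxm : (1 / p + 1 / q) / 2 ∈ Icc (-(2 * R)) (2 * R) := ⟨by linarith, by linarith⟩
  have hym : (1 / p - 1 / q) / 2 ∈ Icc (-(2 * R)) (2 * R) := ⟨by linarith, by linarith⟩
  have hym' : -((1 / p - 1 / q) / 2) ∈ Icc (-(2 * R)) (2 * R) := ⟨by linarith, by linarith⟩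
  refine ⟨?_, ?_, ?_⟩
  · have := abs_prim_sub_le h.continuous hS hxm hym'
    rw [prim_neg h.even, sub_neg_eq_add, sub_neg_eq_add, ← add_div,
      show (1 / p + 1 / q + (1 / p - 1 / q)) / 2 = 1 / p by ring, abs_of_pos ha] at this
    rw [abs_mul, abs_of_pos hp]
    calc p * _ ≤ p * (S * (1 / p)) := by gcongr
      _ = S := by field_simp
  · have := abs_prim_sub_le h.continuous hS hxm hym
    rw [← sub_div, show (1 / p + 1 / q - (1 / p - 1 / q)) / 2 = 1 / q by ring, abs_of_pos hb]
      at this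
    rw [abs_mul, abs_of_pos hq]
    calc q * _ ≤ q * (S * (1 / q)) := by gcongr
      _ = S := by field_simp
  · obtain ⟨h1, h2⟩ := (h.mono hl).pair_moment_bounds le_rfl ha hb hpR hqR
    rw [show 2 * p * q = 2 / (1 / p * (1 / q)) by field_simp]
    have b1 := abs_le.1 (hS _ hxm)
    have b2 := abs_le.1 (hS _ hym)
    exact abs_le.2 ⟨by linarith, by linarith⟩

theorem HasSlopeBounds.abs_pairEnergy_le (h : HasSlopeBounds lam L (2 * R) W) (hl : 0 ≤ lam)
    (hS : ∀ z ∈ Icc (-(2 * R)) (2 * R), |W z| ≤ S)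
    (hp : 0 < p) (hq : 0 < q) (hpR : 1 / p ≤ 2 * R) (hqR : 1 / q ≤ 2 * R) :
    |pairEnergy W p q| ≤ 3 * S := by
  obtain ⟨h1, h2, h3⟩ := h.pair_mean_bounds hl hS hp hq hpR hqR
  rw [pairEnergy]
  exact (abs_sub _ _).trans (by linarith [abs_add_le (p * (prim W ((1 / p + 1 / q) / 2) +
    prim W ((1 / p - 1 / q) / 2))) (q * (prim W ((1 / p + 1 / q) / 2) -
    prim W ((1 / p - 1 / q) / 2)))])

theorem HasSlopeBounds.abs_pairEnergyD_le (h : HasSlopeBounds lam L (2 * R) W) (hl : 0 ≤ lam)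
    (hS : ∀ z ∈ Icc (-(2 * R)) (2 * R), |W z| ≤ S)
    (hp : 0 < p) (hq : 0 < q) (hpR : 1 / p ≤ 2 * R) (hqR : 1 / q ≤ 2 * R) {p' q' C : ℝ}
    (hp' : |p' / p| ≤ C) (hq' : |q' / q| ≤ C) :
    |pairEnergyD W p q p' q'| ≤ 4 * S * C := by
  obtain ⟨h1, h2, h3⟩ := h.pair_mean_bounds hl hS hp hq hpR hqR
  have hS0 : 0 ≤ S := (abs_nonneg _).trans h1
  rw [pairEnergyD]
  refine (abs_add_le _ _).trans ?_
  rw [abs_mul, abs_mul]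
  have i1 := (abs_sub (p * (prim W ((1 / p + 1 / q) / 2) + prim W ((1 / p - 1 / q) / 2)))
    (2 * p * q * (momentPrim W ((1 / p + 1 / q) / 2) - momentPrim W ((1 / p - 1 / q) / 2)))).trans
    (add_le_add h1 h3)
  have i2 := (abs_sub (q * (prim W ((1 / p + 1 / q) / 2) - prim W ((1 / p - 1 / q) / 2)))
    (2 * p * q * (momentPrim W ((1 / p + 1 / q) / 2) - momentPrim W ((1 / p - 1 / q) / 2)))).trans
    (add_le_add h2 h3)
  have j1 := mul_le_mul i1 hp' (abs_nonneg _) (by linarith)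
  have j2 := mul_le_mul i2 hq' (abs_nonneg _) (by linarith)
  linarith

theorem HasSlopeBounds.abs_pairEnergyD2_le (h : HasSlopeBounds lam L (2 * R) W) (hl : 0 ≤ lam)
    (hS : ∀ z ∈ Icc (-(2 * R)) (2 * R), |W z| ≤ S)
    (hp : 0 < p) (hq : 0 < q) (hpR : 1 / p ≤ 2 * R) (hqR : 1 / q ≤ 2 * R) {p' q' C : ℝ}
    (hp' : |p' / p| ≤ C) (hq' : |q' / q| ≤ C) :
    |pairEnergyD2 W p q p' q'| ≤ (2 * L * R + 4 * S) * C ^ 2 := by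
  have ha : 0 < 1 / p := one_div_pos.2 hp
  have hb : 0 < 1 / q := one_div_pos.2 hq
  have hxm : (1 / p + 1 / q) / 2 ∈ Icc (-(2 * R)) (2 * R) := ⟨by linarith, by linarith⟩
  have hym : (1 / p - 1 / q) / 2 ∈ Icc (-(2 * R)) (2 * R) := ⟨by linarith, by linarith⟩
  obtain ⟨-, -, h3⟩ := h.pair_mean_bounds hl hS hp hq hpR hqR
  have hS0 : 0 ≤ S := (abs_nonneg _).trans h3
  have hC0 : 0 ≤ C := (abs_nonneg _).trans hp'
  have hd := h.sub_pair_le ha hb hpR hqR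
  obtain ⟨m1, m2⟩ := (h.mono hl).pair_moment_bounds le_rfl ha hb hpR hqR
  have hD : 0 ≤ W ((1 / p + 1 / q) / 2) - W ((1 / p - 1 / q) / 2) := by linarith
  have hmin : 0 < min (1 / p) (1 / q) := lt_min ha hb
  have hL : 0 ≤ L := nonneg_of_mul_nonneg_left (hD.trans hd) hmin
  have b1 := abs_le.1 (hS _ hxm)
  have b2 := abs_le.1 (hS _ hym)
  have b3 := abs_le.1 h3
  have e2 : (p' / p) ^ 2 ≤ C ^ 2 := by rw [← sq_abs]; gcongr
  have e3 : (q' / q) ^ 2 ≤ C ^ 2 := by rw [← sq_abs]; gcongr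
  -- The factor `min (1/p) (1/q)` from the slope bound absorbs the quotients `q/p` and `p/q`.
  have c1 : (W ((1 / p + 1 / q) / 2) - W ((1 / p - 1 / q) / 2)) * (q / (2 * p)) ≤ L * R := by
    calc _ ≤ L * (1 / q) * (q / (2 * p)) :=
          mul_le_mul_of_nonneg_right (hd.trans (mul_le_mul_of_nonneg_left (min_le_right _ _) hL))
            (by positivity)
      _ = L * ((1 / p) / 2) := by field_simp
      _ ≤ L * R := by gcongr; linarith
  have c2 : (W ((1 / p + 1 / q) / 2) - W ((1 / p - 1 / q) / 2)) * (p / (2 * q)) ≤ L * R := by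
    calc _ ≤ L * (1 / p) * (p / (2 * q)) :=
          mul_le_mul_of_nonneg_right (hd.trans (mul_le_mul_of_nonneg_left (min_le_left _ _) hL))
            (by positivity)
      _ = L * ((1 / q) / 2) := by field_simp
      _ ≤ L * R := by gcongr; linarith
  have hLR : 0 ≤ L * R := (mul_nonneg hD (by positivity)).trans c1
  rw [pairEnergyD2]
  refine (abs_add_le _ _).trans ?_
  have t1 : |(W ((1 / p + 1 / q) / 2) - W ((1 / p - 1 / q) / 2)) *
      (q / (2 * p) * (p' / p) ^ 2 + p / (2 * q) * (q' / q) ^ 2)| ≤ 2 * L * R * C ^ 2 := by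
    rw [abs_of_nonneg (mul_nonneg hD (by positivity))]
    have k1 := mul_le_mul c1 e2 (by positivity) hLR
    have k2 := mul_le_mul c2 e3 (by positivity) hLR
    linarith
  have t2 : |(W ((1 / p + 1 / q) / 2) + W ((1 / p - 1 / q) / 2) - 4 * p * q *
      (momentPrim W ((1 / p + 1 / q) / 2) - momentPrim W ((1 / p - 1 / q) / 2))) *
      (p' / p * (q' / q))| ≤ 4 * S * C ^ 2 := by
    rw [abs_mul, abs_mul, sq]
    refine mul_le_mul (abs_le.2 ⟨by linarith, by linarith⟩)
      (mul_le_mul hp' hq' (abs_nonneg _) hC0) (by positivity) (by linarith)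
  linarith

end bounds

/-! ### Height functions -/

/-- Height functions of radially-decreasing densities supported on `[-R, R]`: convex continuous
functions on `[0, 1]` that vanish at `0` and whose slopes are at least `1/(2R)`. -/
structure IsHeightProfile (R : ℝ) (h : ℝ → ℝ) : Prop where
  convex : ConvexOn ℝ (Icc 0 1) h
  continuousOn : ContinuousOn h (Icc 0 1)
  zero : h 0 = 0
  growth : ∀ s s', 0 ≤ s → s ≤ s' → s' ≤ 1 → s' - s ≤ 2 * R * (h s' - h s)

section fromDensity

variable {R : ℝ} {ρ : ℝ → ℝ}

/-- The mass of `ρ` below height `H`. -/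
def massBelow (ρ : ℝ → ℝ) (H : ℝ) : ℝ := ∫ x, min (ρ x) H

theorem IsRadDecDensity.radius_pos (hρ : IsRadDecDensity R ρ) : 0 < R := by
  by_contra! hR
  have : ρ =ᵐ[volume] 0 := by
    filter_upwards [compl_mem_ae_iff.2 (measure_singleton (0 : ℝ))] with x hx
    by_contra hne
    have := hρ.supp hne
    exact hx (by simp only [mem_singleton_iff]; linarith [this.1, this.2])
  have h0 := integral_congr_ae this
  rw [hρ.mass] at h0
  simp at h0

/-- Monotonicity on the closed half-line makes `ρ` bounded by its value at `0`. -/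
theorem IsRadDecDensity.le_zero (hρ : IsRadDecDensity R ρ) (x : ℝ) : ρ x ≤ ρ 0 := by
  rcases le_total 0 x with hx | hx
  · exact hρ.anti (mem_Ici.2 le_rfl) hx hx
  · rw [← hρ.symm]
    exact hρ.anti (mem_Ici.2 le_rfl) (neg_nonneg.2 hx) (neg_nonneg.2 hx)

theorem IsRadDecDensity.integrable_min (hρ : IsRadDecDensity R ρ) {H : ℝ} (hH : 0 ≤ H) :
    Integrable fun x => min (ρ x) H := by
  refine hρ.integrable.mono (hρ.integrable.aestronglyMeasurable.inf aestronglyMeasurable_const)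
    (ae_of_all _ fun x => ?_)
  rw [Real.norm_of_nonneg (le_min (hρ.nonneg x) hH), Real.norm_of_nonneg (hρ.nonneg x)]
  exact min_le_left _ _

theorem IsRadDecDensity.massBelow_mono (hρ : IsRadDecDensity R ρ) {H H' : ℝ} (hH : 0 ≤ H)
    (hHH' : H ≤ H') : massBelow ρ H ≤ massBelow ρ H' :=
  integral_mono (hρ.integrable_min hH) (hρ.integrable_min (hH.trans hHH'))
    fun _ => min_le_min_left _ hHH'

theorem IsRadDecDensity.massBelow_le_one (hρ : IsRadDecDensity R ρ) {H : ℝ} (hH : 0 ≤ H) :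
    massBelow ρ H ≤ 1 := by
  rw [← hρ.mass]
  exact integral_mono (hρ.integrable_min hH) hρ.integrable fun x => min_le_left _ _

theorem IsRadDecDensity.massBelow_sub_le (hρ : IsRadDecDensity R ρ) {H H' : ℝ} (hH : 0 ≤ H)
    (hHH' : H ≤ H') : massBelow ρ H' - massBelow ρ H ≤ 2 * R * (H' - H) := by
  have hi := hρ.integrable_min hH
  have hi' := hρ.integrable_min (hH.trans hHH')
  rw [massBelow, massBelow, ← integral_sub hi' hi]
  have hc : Integrable ((Icc (-R) R).indicator fun _ => H' - H) :=
    (integrable_indicator_iff measurableSet_Icc).2 (by simp)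
  calc _ ≤ ∫ x, (Icc (-R) R).indicator (fun _ => H' - H) x := by
        refine integral_mono (hi'.sub hi) hc fun x => ?_
        by_cases hx : x ∈ Icc (-R) R
        · rw [indicator_of_mem hx]
          rcases le_total (ρ x) H with h1 | h1
          · simp only [min_eq_left h1, min_eq_left (h1.trans hHH')]; linarith
          · simp only [min_eq_right h1]; linarith [min_le_right (ρ x) H']
        · have h0 : ρ x = 0 := Function.notMem_support.1 fun h => hx (hρ.supp h)
          simp [indicator_of_notMem hx, h0, hH, hH.trans hHH']
    _ = 2 * R * (H' - H) := by
        rw [integral_indicator measurableSet_Icc]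
        simp only [integral_const, smul_eq_mul, measureReal_restrict_apply_univ, Real.volume_real_Icc]
        rw [max_eq_left (by linarith [hρ.radius_pos])]
        ring

theorem IsRadDecDensity.continuousOn_massBelow (hρ : IsRadDecDensity R ρ) :
    ContinuousOn (massBelow ρ) (Ici 0) := by
  have hR := hρ.radius_pos
  refine (LipschitzOnWith.of_dist_le_mul (K := (2 * R).toNNReal)
    fun x hx y hy => ?_).continuousOn
  rw [Real.dist_eq, Real.dist_eq, Real.coe_toNNReal _ (by positivity)]
  rcases le_total x y with hxy | hxy
  · rw [abs_sub_comm, abs_sub_comm x, abs_of_nonneg (sub_nonneg.2 (hρ.massBelow_mono hx hxy)),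
      abs_of_nonneg (sub_nonneg.2 hxy)]
    exact hρ.massBelow_sub_le hx hxy
  · rw [abs_of_nonneg (sub_nonneg.2 (hρ.massBelow_mono hy hxy)),
      abs_of_nonneg (sub_nonneg.2 hxy)]
    exact hρ.massBelow_sub_le hy hxy

theorem hFun_le {s H : ℝ} (hH : 0 ≤ H) (hs : s ≤ massBelow ρ H) : hFun ρ s ≤ H :=
  csInf_le ⟨0, fun _ h => h.1⟩ ⟨hH, hs⟩

theorem IsRadDecDensity.hFun_mem (hρ : IsRadDecDensity R ρ) {s : ℝ} (hs : s ≤ 1) :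
    0 ≤ hFun ρ s ∧ s ≤ massBelow ρ (hFun ρ s) := by
  have hcl : IsClosed {H : ℝ | 0 ≤ H ∧ s ≤ ∫ x, min (ρ x) H} :=
    hρ.continuousOn_massBelow.preimage_isClosed_of_isClosed isClosed_Ici (isClosed_Ici (a := s))
  refine hcl.csInf_mem ⟨ρ 0, hρ.nonneg 0, ?_⟩ ⟨0, fun _ h => h.1⟩
  simp only [min_eq_left (hρ.le_zero _), hρ.mass, hs]

theorem IsRadDecDensity.massBelow_hFun (hρ : IsRadDecDensity R ρ) {s : ℝ} (hs0 : 0 ≤ s)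
    (hs : s ≤ 1) : massBelow ρ (hFun ρ s) = s := by
  rcases hs.lt_or_eq with h | rfl
  · exact (integral_min_hFun hρ.nonneg hρ.integrable hρ.mass hs0 h).2
  · exact le_antisymm (hρ.massBelow_le_one (hρ.hFun_mem le_rfl).1) (hρ.hFun_mem le_rfl).2

theorem IsRadDecDensity.hFun_zero (hρ : IsRadDecDensity R ρ) : hFun ρ 0 = 0 := by
  refine le_antisymm (hFun_le le_rfl ?_) (hρ.hFun_mem zero_le_one).1
  simp [massBelow, hρ.nonneg]

theorem IsRadDecDensity.hFun_mono (hρ : IsRadDecDensity R ρ) {s s' : ℝ} (hss' : s ≤ s')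
    (hs' : s' ≤ 1) : hFun ρ s ≤ hFun ρ s' :=
  hFun_le (hρ.hFun_mem hs').1 (hss'.trans (hρ.hFun_mem hs').2)

/-- The mass below a height is concave in the height, so its inverse `hFun ρ` is convex. -/
theorem IsRadDecDensity.convexOn_hFun (hρ : IsRadDecDensity R ρ) :
    ConvexOn ℝ (Icc 0 1) (hFun ρ) := by
  refine ⟨convex_Icc 0 1, fun s hs s' hs' a b ha hb hab => ?_⟩
  simp only [smul_eq_mul]
  have m := hρ.hFun_mem hs.2
  have m' := hρ.hFun_mem hs'.2
  have h0 : 0 ≤ a * hFun ρ s + b * hFun ρ s' :=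
    add_nonneg (mul_nonneg ha m.1) (mul_nonneg hb m'.1)
  refine hFun_le h0 ?_
  calc a * s + b * s' ≤ a * massBelow ρ (hFun ρ s) + b * massBelow ρ (hFun ρ s') :=
        add_le_add (mul_le_mul_of_nonneg_left m.2 ha) (mul_le_mul_of_nonneg_left m'.2 hb)
    _ = ∫ x, (a * min (ρ x) (hFun ρ s) + b * min (ρ x) (hFun ρ s')) := by
        rw [integral_add ((hρ.integrable_min m.1).const_mul a)
          ((hρ.integrable_min m'.1).const_mul b), integral_const_mul, integral_const_mul]
        rfl
    _ ≤ massBelow ρ (a * hFun ρ s + b * hFun ρ s') := by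
        refine integral_mono (((hρ.integrable_min m.1).const_mul a).add
          ((hρ.integrable_min m'.1).const_mul b)) (hρ.integrable_min h0) fun x => ?_
        refine le_min ?_ ?_
        · calc a * min (ρ x) (hFun ρ s) + b * min (ρ x) (hFun ρ s') ≤ a * ρ x + b * ρ x :=
                add_le_add (mul_le_mul_of_nonneg_left (min_le_left _ _) ha)
                  (mul_le_mul_of_nonneg_left (min_le_left _ _) hb)
            _ = ρ x := by rw [← add_mul, hab, one_mul]
        · exact add_le_add (mul_le_mul_of_nonneg_left (min_le_right _ _) ha)
            (mul_le_mul_of_nonneg_left (min_le_right _ _) hb)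

/-- Continuity up to `s = 1` matters: on a plateau of `ρ` at its maximum the distribution is
recovered from the value of `h` at `1` itself. -/
theorem IsRadDecDensity.continuousOn_hFun (hρ : IsRadDecDensity R ρ) :
    ContinuousOn (hFun ρ) (Icc 0 1) := by
  intro s₀ hs₀
  by_cases hint : s₀ ∈ Ioo (0 : ℝ) 1
  · have := hρ.convexOn_hFun.continuousOn_interior
    rw [interior_Icc] at this
    exact (this.continuousAt (isOpen_Ioo.mem_nhds hint)).continuousWithinAt
  have hend : s₀ = 0 ∨ s₀ = 1 := by
    by_contra! hne
    exact hint ⟨lt_of_le_of_ne hs₀.1 hne.1.symm, lt_of_le_of_ne hs₀.2 hne.2⟩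
  rcases hend with rfl | rfl
  · -- At `0` convexity gives the chord bound `h(s) ≤ s h(1)`.
    have hup : Tendsto (fun s => s * hFun ρ 1) (𝓝[Icc 0 1] 0) (𝓝 0) := by
      have : ContinuousWithinAt (fun s => s * hFun ρ 1) (Icc 0 1) 0 := by fun_prop
      simpa using this.tendsto
    rw [ContinuousWithinAt, hρ.hFun_zero]
    refine squeeze_zero' ?_ ?_ hup
    · filter_upwards [self_mem_nhdsWithin] with s hs using (hρ.hFun_mem hs.2).1
    · filter_upwards [self_mem_nhdsWithin] with s hs
      have := hρ.convexOn_hFun.2 (left_mem_Icc.2 zero_le_one) (right_mem_Icc.2 zero_le_one)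
        (sub_nonneg.2 hs.2) hs.1 (by ring)
      simpa [hρ.hFun_zero] using this
  · -- At `1` minimality of `h(1)` means that every smaller height leaves some mass above it.
    rw [ContinuousWithinAt, tendsto_order]
    constructor
    · intro a ha
      rcases lt_or_ge a 0 with h0 | h0
      · filter_upwards [self_mem_nhdsWithin] with s hs using h0.trans_le (hρ.hFun_mem hs.2).1
      · have hlt : massBelow ρ a < 1 := by
          by_contra! h
          exact absurd (hFun_le h0 h) (not_le.2 ha)
        filter_upwards [self_mem_nhdsWithin, mem_nhdsWithin_of_mem_nhds (lt_mem_nhds hlt)]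
          with s hs hlts
        by_contra! hle
        have := hρ.massBelow_mono (hρ.hFun_mem hs.2).1 hle
        rw [hρ.massBelow_hFun hs.1 hs.2] at this
        exact absurd this (not_le.2 hlts)
    · intro a ha
      filter_upwards [self_mem_nhdsWithin] with s hs using (hρ.hFun_mono hs.2 le_rfl).trans_lt ha

theorem IsRadDecDensity.isHeightProfile (hρ : IsRadDecDensity R ρ) :
    IsHeightProfile R (hFun ρ) where
  convex := hρ.convexOn_hFun
  continuousOn := hρ.continuousOn_hFun
  zero := hρ.hFun_zero
  growth s s' hs hss' hs' := by
    have h := hρ.massBelow_sub_le (hρ.hFun_mem (hss'.trans hs')).1 (hρ.hFun_mono hss' hs')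
    rwa [hρ.massBelow_hFun hs (hss'.trans hs'), hρ.massBelow_hFun (hs.trans hss') hs'] at h

end fromDensity

/-- The right derivative of `h`, which for convex `h` exists at every interior point and agrees
with `deriv h` almost everywhere. -/
def rightSlope (h : ℝ → ℝ) (s : ℝ) : ℝ := derivWithin h (Ioi s) s

theorem measurable_rightSlope (h : ℝ → ℝ) : Measurable (rightSlope h) :=
  measurable_derivWithin_Ioi h

namespace IsHeightProfile

variable {R : ℝ} {h : ℝ → ℝ}

theorem hasDerivWithinAt (hh : IsHeightProfile R h) {s : ℝ} (hs : s ∈ Ioo (0 : ℝ) 1) :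
    HasDerivWithinAt h (rightSlope h s) (Ioi s) s :=
  hh.convex.hasDerivWithinAt_rightDeriv_of_mem_interior (by rwa [interior_Icc])

theorem monotoneOn_rightSlope (hh : IsHeightProfile R h) :
    MonotoneOn (rightSlope h) (Ioo 0 1) := by
  have := hh.convex.monotoneOn_rightDeriv
  rwa [interior_Icc] at this

theorem growth_div (hh : IsHeightProfile R h) (hR : 0 < R) {s s' : ℝ} (hs : 0 ≤ s)
    (hss' : s ≤ s') (hs' : s' ≤ 1) : (s' - s) / (2 * R) ≤ h s' - h s := by
  rw [div_le_iff₀ (by positivity), mul_comm]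
  exact hh.growth s s' hs hss' hs'

theorem monotoneOn (hh : IsHeightProfile R h) (hR : 0 < R) : MonotoneOn h (Icc 0 1) :=
  fun s hs s' hs' hss' => by
    have := hh.growth_div hR hs.1 hss' hs'.2
    have : 0 ≤ (s' - s) / (2 * R) := div_nonneg (by linarith) (by linarith)
    linarith

theorem pos (hh : IsHeightProfile R h) (hR : 0 < R) {s : ℝ} (hs0 : 0 < s) (hs1 : s ≤ 1) :
    0 < h s := by
  have := hh.growth_div hR le_rfl hs0.le hs1
  rw [hh.zero, sub_zero, sub_zero] at this
  exact (by positivity : 0 < s / (2 * R)).trans_le this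

theorem le_rightSlope (hh : IsHeightProfile R h) (hR : 0 < R) {s : ℝ} (hs : s ∈ Ioo (0 : ℝ) 1) :
    1 / (2 * R) ≤ rightSlope h s := by
  have ht := (hasDerivWithinAt_iff_tendsto_slope' self_notMem_Ioi).1 (hh.hasDerivWithinAt hs)
  refine ge_of_tendsto ht ?_
  filter_upwards [Ioo_mem_nhdsGT hs.2] with r hr
  rw [slope_def_field, div_le_div_iff₀ (by positivity) (sub_pos.2 hr.1), one_mul, mul_comm]
  exact hh.growth s r hs.1.le hr.1.le hr.2.le

theorem rightSlope_pos (hh : IsHeightProfile R h) (hR : 0 < R) {s : ℝ}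
    (hs : s ∈ Ioo (0 : ℝ) 1) : 0 < rightSlope h s :=
  (by positivity : 0 < 1 / (2 * R)).trans_le (hh.le_rightSlope hR hs)

theorem one_div_rightSlope_le (hh : IsHeightProfile R h) (hR : 0 < R) {s : ℝ}
    (hs : s ∈ Ioo (0 : ℝ) 1) : 1 / rightSlope h s ≤ 2 * R :=
  one_div_le (by positivity) (hh.rightSlope_pos hR hs) |>.1 (hh.le_rightSlope hR hs)

theorem ae_hasDerivAt (hh : IsHeightProfile R h) (hR : 0 < R) :
    ∀ᵐ s ∂volume.restrict (Ioo (0 : ℝ) 1), HasDerivAt h (rightSlope h s) s := by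
  have := (hh.monotoneOn hR).ae_differentiableWithinAt_of_mem
  filter_upwards [ae_restrict_of_ae this, ae_restrict_mem measurableSet_Ioo] with s hs hmem
  have hd := (hs (Ioo_subset_Icc_self hmem)).differentiableAt (Icc_mem_nhds hmem.1 hmem.2)
  have he : rightSlope h s = deriv h s :=
    (hd.hasDerivAt.hasDerivWithinAt).derivWithin (uniqueDiffWithinAt_Ioi s)
  rw [he]
  exact hd.hasDerivAt

theorem combination {h₀ h₁ : ℝ → ℝ} (hh₀ : IsHeightProfile R h₀) (hh₁ : IsHeightProfile R h₁)
    {t : ℝ} (ht : t ∈ Icc (0 : ℝ) 1) :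
    IsHeightProfile R (fun s => (1 - t) * h₀ s + t * h₁ s) where
  convex := (hh₀.convex.smul (sub_nonneg.2 ht.2)).add (hh₁.convex.smul ht.1)
  continuousOn := (continuousOn_const.mul hh₀.continuousOn).add
    (continuousOn_const.mul hh₁.continuousOn)
  zero := by simp [hh₀.zero, hh₁.zero]
  growth s s' hs hss' hs' := by
    have h0 := mul_le_mul_of_nonneg_left (hh₀.growth s s' hs hss' hs') (sub_nonneg.2 ht.2)
    have h1 := mul_le_mul_of_nonneg_left (hh₁.growth s s' hs hss' hs') ht.1
    linarith

theorem rightSlope_combination {h₀ h₁ : ℝ → ℝ} (hh₀ : IsHeightProfile R h₀)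
    (hh₁ : IsHeightProfile R h₁) (t : ℝ) {s : ℝ} (hs : s ∈ Ioo (0 : ℝ) 1) :
    rightSlope (fun s => (1 - t) * h₀ s + t * h₁ s) s =
      (1 - t) * rightSlope h₀ s + t * rightSlope h₁ s :=
  (((hh₀.hasDerivWithinAt hs).const_mul (1 - t)).add
    ((hh₁.hasDerivWithinAt hs).const_mul t)).derivWithin (uniqueDiffWithinAt_Ioi s)

end IsHeightProfile

/-! ### The energy in height variables -/

/-- Lebesgue measure on the interval `(0, 1)` of the height parameter `s`. -/
abbrev unitVolume : Measure ℝ := volume.restrict (Ioo (0 : ℝ) 1)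

/-- The layer-cake kernel `h'(s) 1_{𝒞(s)}(x)`, formed with the right derivative of `h`; the
condition `2 h'(s) |x| ≤ 1` is membership of `x` in `𝒞(s)`. -/
def layerKernel (h : ℝ → ℝ) (s x : ℝ) : ℝ :=
  if 2 * rightSlope h s * |x| ≤ 1 then rightSlope h s else 0

/-- The supremum that `ofHFun` evaluates `h` at. -/
def topLevel (h : ℝ → ℝ) (x : ℝ) : ℝ :=
  sSup {s | s ∈ Ioo (0 : ℝ) 1 ∧ x ∈ levelInterval h s}

theorem topLevel_mem (h : ℝ → ℝ) (x : ℝ) : topLevel h x ∈ Icc (0 : ℝ) 1 :=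
  ⟨Real.sSup_nonneg fun _ hs => hs.1.1.le, Real.sSup_le (fun _ hs => hs.1.2.le) zero_le_one⟩

theorem measurable_layerKernel (h : ℝ → ℝ) :
    Measurable fun z : ℝ × ℝ => layerKernel h z.1 z.2 := by
  have := measurable_rightSlope h
  refine Measurable.ite (measurableSet_le ?_ measurable_const) (by fun_prop) measurable_const
  fun_prop

namespace IsHeightProfile

variable {R : ℝ} {h : ℝ → ℝ}

/-- Monotonicity of `h'` makes `{s : x ∈ 𝒞(s)}` an initial segment up to a null set.  A junk value
`deriv h s = 0` shrinks `𝒞(s)` to `{0}`, hence the exclusion of `x = 0`. -/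
theorem ae_level_iff (hh : IsHeightProfile R h) (hR : 0 < R) {x : ℝ} (hx : x ≠ 0) :
    ∀ᵐ s ∂unitVolume, (2 * rightSlope h s * |x| ≤ 1 ↔ s ≤ topLevel h x) := by
  have hx' : 0 < |x| := abs_pos.2 hx
  have hbdd : BddAbove {s | s ∈ Ioo (0 : ℝ) 1 ∧ x ∈ levelInterval h s} :=
    ⟨1, fun _ hs => hs.1.2.le⟩
  have hlevel : ∀ s d, deriv h s = d → 0 < d → (x ∈ levelInterval h s ↔ 2 * d * |x| ≤ 1) := by
    rintro s _ rfl hd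
    rw [levelInterval, mem_Icc, ← abs_le, le_div_iff₀ (by positivity), mul_comm]
  filter_upwards [hh.ae_hasDerivAt hR, ae_restrict_mem measurableSet_Ioo,
    ae_restrict_of_ae (compl_mem_ae_iff.2 (measure_singleton (topLevel h x)))] with s hs hmem hne
  constructor
  · intro hle
    exact le_csSup hbdd ⟨hmem, (hlevel s _ hs.deriv (hh.rightSlope_pos hR hmem)).2 hle⟩
  · intro hle
    have hlt : s < topLevel h x := lt_of_le_of_ne hle hne
    have hnonempty : {s | s ∈ Ioo (0 : ℝ) 1 ∧ x ∈ levelInterval h s}.Nonempty := by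
      by_contra! hemp
      rw [topLevel, hemp, Real.sSup_empty] at hlt
      exact absurd hmem.1 hlt.not_gt
    obtain ⟨s', ⟨hs', hxs'⟩, hss'⟩ := exists_lt_of_lt_csSup hnonempty hlt
    have hd : deriv h s' ≠ 0 := by
      intro h0
      rw [levelInterval, h0] at hxs'
      simp only [mul_zero, div_zero, neg_zero, Icc_self, mem_singleton_iff] at hxs'
      exact hx hxs'
    have hdiff := differentiableAt_of_deriv_ne_zero hd
    have he : deriv h s' = rightSlope h s' :=
      ((hdiff.hasDerivAt.hasDerivWithinAt).derivWithin (uniqueDiffWithinAt_Ioi s')).symm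
    have h1 := (hlevel s' _ he (hh.rightSlope_pos hR hs')).1 hxs'
    have h2 := hh.monotoneOn_rightSlope hmem hs' hss'.le
    calc 2 * rightSlope h s * |x| ≤ 2 * rightSlope h s' * |x| := by gcongr
      _ ≤ 1 := h1

theorem integrable_rightSlope (hh : IsHeightProfile R h) (hR : 0 < R) :
    Integrable (rightSlope h) unitVolume := by
  have := intervalIntegral.integrableOn_deriv_right_of_nonneg hh.continuousOn
    (fun s hs => hh.hasDerivWithinAt hs) fun s hs => (hh.rightSlope_pos hR hs).le
  rwa [integrableOn_Ioc_iff_integrableOn_Ioo] at this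

theorem aestronglyMeasurable_comp (hh : IsHeightProfile R h) {φ : ℝ → ℝ} (hφ : Continuous φ) :
    AEStronglyMeasurable (fun s => φ (h s)) unitVolume :=
  (hφ.comp_continuousOn (hh.continuousOn.mono Ioo_subset_Icc_self)).aestronglyMeasurable
    measurableSet_Ioo

theorem exists_bound_comp (hh : IsHeightProfile R h) {φ : ℝ → ℝ} (hφ : Continuous φ) :
    ∃ C, 0 ≤ C ∧ ∀ s ∈ Icc (0 : ℝ) 1, |φ (h s)| ≤ C := by
  obtain ⟨C, hC⟩ := isCompact_Icc.exists_bound_of_continuousOn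
    (hφ.comp_continuousOn hh.continuousOn)
  exact ⟨C, (norm_nonneg _).trans (hC 0 (left_mem_Icc.2 zero_le_one)), hC⟩

/-- Layer-cake formula for `φ(ρ(x))`, where `ρ` is the distribution with `h(s)`-representation
`h`: the fundamental theorem of calculus for `φ ∘ h` up to the top level at `x`. -/
theorem comp_ofHFun (hh : IsHeightProfile R h) (hR : 0 < R) {φ φ' : ℝ → ℝ}
    (hφ : ∀ y, HasDerivAt φ (φ' y) y) (hφ' : Continuous φ') {x : ℝ} (hx : x ≠ 0) :
    φ (ofHFun h x) - φ 0 = ∫ s, φ' (h s) * layerKernel h s x ∂unitVolume := by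
  have hσ := topLevel_mem h x
  have hsub : Icc 0 (topLevel h x) ⊆ Icc (0 : ℝ) 1 := Icc_subset_Icc_right hσ.2
  have hsub' : Ioo 0 (topLevel h x) ⊆ Ioo (0 : ℝ) 1 := Ioo_subset_Ioo_right hσ.2
  obtain ⟨C, -, hC⟩ := hh.exists_bound_comp hφ'
  have hint : Integrable (fun s => φ' (h s) * rightSlope h s) unitVolume := by
    refine (hh.integrable_rightSlope hR).bdd_mul (c := C) (hh.aestronglyMeasurable_comp hφ') ?_
    filter_upwards [ae_restrict_mem measurableSet_Ioo] with s hs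
    exact hC s (Ioo_subset_Icc_self hs)
  have hφc : Continuous φ := continuous_iff_continuousAt.2 fun y => (hφ y).continuousAt
  have hftc : ∫ s in (0 : ℝ)..topLevel h x, φ' (h s) * rightSlope h s =
      φ (h (topLevel h x)) - φ (h 0) := by
    refine intervalIntegral.integral_eq_sub_of_hasDeriv_right_of_le (f := fun s => φ (h s)) hσ.1
      (hφc.comp_continuousOn (hh.continuousOn.mono hsub)) (fun s hs => ?_) ?_
    · exact (hφ (h s)).comp_hasDerivWithinAt s (hh.hasDerivWithinAt (hsub' hs))
    · rw [intervalIntegrable_iff_integrableOn_Ioo_of_le hσ.1]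
      exact IntegrableOn.mono_set hint hsub'
  rw [hh.zero, intervalIntegral.integral_of_le hσ.1, integral_Ioc_eq_integral_Ioo] at hftc
  have hind : ∫ s in Ioo 0 (topLevel h x), φ' (h s) * rightSlope h s =
      ∫ s, (Iio (topLevel h x)).indicator (fun s => φ' (h s) * rightSlope h s) s ∂unitVolume := by
    rw [integral_indicator measurableSet_Iio, Measure.restrict_restrict measurableSet_Iio,
      inter_comm, Ioo_inter_Iio, min_eq_right hσ.2]
  rw [show ofHFun h x = h (topLevel h x) from rfl, ← hftc, hind]
  refine integral_congr_ae ?_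
  filter_upwards [hh.ae_level_iff hR hx,
    ae_restrict_of_ae (compl_mem_ae_iff.2 (measure_singleton (topLevel h x)))] with s hs hne
  by_cases hle : s ≤ topLevel h x
  · rw [indicator_of_mem (mem_Iio.2 (lt_of_le_of_ne hle hne)), layerKernel,
      if_pos (hs.2 hle)]
  · rw [indicator_of_notMem (fun h' => hle (mem_Iio.1 h').le), layerKernel,
      if_neg (fun h' => hle (hs.1 h')), mul_zero]

theorem layerKernel_mul_eq_indicator (hh : IsHeightProfile R h) (hR : 0 < R) (Ψ : ℝ → ℝ) {s : ℝ}
    (hs : s ∈ Ioo (0 : ℝ) 1) :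
    (fun x => layerKernel h s x * Ψ x) =
      (Icc (-(1 / rightSlope h s / 2)) (1 / rightSlope h s / 2)).indicator
        fun x => rightSlope h s * Ψ x := by
  have hp := hh.rightSlope_pos hR hs
  ext x
  have : x ∈ Icc (-(1 / rightSlope h s / 2)) (1 / rightSlope h s / 2) ↔
      2 * rightSlope h s * |x| ≤ 1 := by
    rw [mem_Icc, ← abs_le, div_div, le_div_iff₀ (by positivity)]
    ring_nf
  by_cases hx : 2 * rightSlope h s * |x| ≤ 1
  · rw [indicator_of_mem (this.2 hx), layerKernel, if_pos hx]
  · rw [indicator_of_notMem (mt this.1 hx), layerKernel, if_neg hx, zero_mul]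

theorem integral_layerKernel_mul (hh : IsHeightProfile R h) (hR : 0 < R) (Ψ : ℝ → ℝ) {s : ℝ}
    (hs : s ∈ Ioo (0 : ℝ) 1) :
    ∫ x, layerKernel h s x * Ψ x =
      rightSlope h s * ∫ x in (-(1 / rightSlope h s / 2))..(1 / rightSlope h s / 2), Ψ x := by
  have hp := hh.rightSlope_pos hR hs
  have ha : 0 < 1 / rightSlope h s := one_div_pos.2 hp
  rw [hh.layerKernel_mul_eq_indicator hR Ψ hs, integral_indicator measurableSet_Icc,
    integral_const_mul, integral_Icc_eq_integral_Ioc,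
    intervalIntegral.integral_of_le (by linarith)]

/-- Fubini for the layer-cake kernel against test functions in `s` and in `x`. -/
theorem integral_mul_layerKernel_swap (hh : IsHeightProfile R h) (hR : 0 < R) {c Ψ : ℝ → ℝ}
    {C S : ℝ} (hc : AEStronglyMeasurable c unitVolume) (hC : ∀ s ∈ Ioo (0 : ℝ) 1, |c s| ≤ C)
    (hΨ : Measurable Ψ) (hS : ∀ x ∈ Icc (-R) R, |Ψ x| ≤ S) :
    ∫ x, (∫ s, c s * layerKernel h s x ∂unitVolume) * Ψ x =
      ∫ s, c s * (rightSlope h s *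
        ∫ x in (-(1 / rightSlope h s / 2))..(1 / rightSlope h s / 2), Ψ x) ∂unitVolume := by
  have hS0 : 0 ≤ S := (abs_nonneg _).trans (hS 0 ⟨by linarith, hR.le⟩)
  have hC0 : 0 ≤ C := (abs_nonneg _).trans (hC (1 / 2) (by norm_num))
  have hmeas : AEStronglyMeasurable (fun z : ℝ × ℝ => c z.1 * (layerKernel h z.1 z.2 * Ψ z.2))
      (unitVolume.prod volume) :=
    hc.comp_fst.mul ((measurable_layerKernel h).mul
      (hΨ.comp measurable_snd)).aestronglyMeasurable
  have hfin : ∀ s ∈ Ioo (0 : ℝ) 1, Integrable fun x => c s * (layerKernel h s x * Ψ x) := by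
    intro s hs
    have hp := hh.rightSlope_pos hR hs
    have hle := hh.one_div_rightSlope_le hR hs
    refine Integrable.const_mul ?_ _
    rw [hh.layerKernel_mul_eq_indicator hR Ψ hs, integrable_indicator_iff measurableSet_Icc]
    refine Integrable.const_mul ?_ _
    refine Measure.integrableOn_of_bounded (M := S) measure_Icc_lt_top.ne
      hΨ.aestronglyMeasurable ?_
    filter_upwards [ae_restrict_mem measurableSet_Icc] with x hx
    exact hS x ⟨by linarith [hx.1], by linarith [hx.2]⟩
  have hint : Integrable (fun z : ℝ × ℝ => c z.1 * (layerKernel h z.1 z.2 * Ψ z.2))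
      (unitVolume.prod volume) := by
    rw [integrable_prod_iff hmeas]
    refine ⟨?_, ?_⟩
    · filter_upwards [ae_restrict_mem measurableSet_Ioo] with s hs using hfin s hs
    · refine Integrable.of_bound hmeas.norm.integral_prod_right' (C * S) ?_
      filter_upwards [ae_restrict_mem measurableSet_Ioo] with s hs
      have hp := hh.rightSlope_pos hR hs
      have ha : 0 < 1 / rightSlope h s := one_div_pos.2 hp
      have hle := hh.one_div_rightSlope_le hR hs
      have he : ∀ x, ‖c s * (layerKernel h s x * Ψ x)‖ =
          |c s| * (layerKernel h s x * |Ψ x|) := fun x => by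
        have : 0 ≤ layerKernel h s x := by
          rw [layerKernel]
          split_ifs
          exacts [hp.le, le_rfl]
        rw [Real.norm_eq_abs, abs_mul, abs_mul, abs_of_nonneg this]
      simp only [he]
      rw [integral_const_mul, hh.integral_layerKernel_mul hR (fun x => |Ψ x|) hs]
      have hI : |(∫ x in (-(1 / rightSlope h s / 2))..(1 / rightSlope h s / 2), |Ψ x|)| ≤
          S * (1 / rightSlope h s) := by
        have := intervalIntegral.norm_integral_le_of_norm_le_const (C := S)
          (f := fun x => |Ψ x|) (a := -(1 / rightSlope h s / 2)) (b := 1 / rightSlope h s / 2)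
          fun x hx => by
            rw [uIoc_of_le (by linarith)] at hx
            rw [Real.norm_eq_abs, abs_abs]
            exact hS x ⟨by linarith [hx.1], by linarith [hx.2]⟩
        rwa [sub_neg_eq_add, add_halves, abs_of_pos ha] at this
      rw [Real.norm_eq_abs, abs_mul, abs_abs, abs_mul, abs_of_pos hp]
      calc _ ≤ C * (rightSlope h s * (S * (1 / rightSlope h s))) := by
            gcongr
            exact hC s hs
        _ = C * S := by field_simp
  have hswap := integral_integral_swap (f := fun s x => c s * (layerKernel h s x * Ψ x)) hint
  calc _ = ∫ x, ∫ s, c s * (layerKernel h s x * Ψ x) ∂unitVolume := by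
        congr 1; ext x
        rw [← integral_mul_const]
        simp only [mul_assoc]
    _ = ∫ s, (∫ x, c s * (layerKernel h s x * Ψ x)) ∂unitVolume := hswap.symm
    _ = _ := by
        refine integral_congr_ae ?_
        filter_upwards [ae_restrict_mem measurableSet_Ioo] with s hs
        rw [integral_const_mul, hh.integral_layerKernel_mul hR Ψ hs]

theorem integral_ofHFun_mul (hh : IsHeightProfile R h) (hR : 0 < R) {Ψ : ℝ → ℝ} {S : ℝ}
    (hΨ : Measurable Ψ) (hS : ∀ x ∈ Icc (-R) R, |Ψ x| ≤ S) :
    ∫ x, Ψ x * ofHFun h x = ∫ s, rightSlope h s *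
        (∫ x in (-(1 / rightSlope h s / 2))..(1 / rightSlope h s / 2), Ψ x) ∂unitVolume := by
  have := hh.integral_mul_layerKernel_swap hR (c := fun _ => 1) (C := 1)
    aestronglyMeasurable_const (by simp) hΨ hS
  simp only [one_mul] at this
  rw [← this]
  refine integral_congr_ae ?_
  filter_upwards [compl_mem_ae_iff.2 (measure_singleton (0 : ℝ))] with x hx
  have := hh.comp_ofHFun hR (φ := id) (φ' := fun _ => 1) (fun y => hasDerivAt_id y)
    continuous_const hx
  simp only [id, sub_zero, one_mul] at this
  rw [mul_comm, this]

/-- The internal energy in height variables: `∫ ρ^m = m ∫₀¹ h^(m-1)`. -/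
theorem integral_ofHFun_rpow (hh : IsHeightProfile R h) (hR : 0 < R) {m : ℝ} (hm : 2 ≤ m) :
    ∫ x, ofHFun h x ^ m = m * ∫ s, h s ^ (m - 1) ∂unitVolume := by
  have hcont : Continuous fun y : ℝ => m * y ^ (m - 1) :=
    continuous_const.mul (Real.continuous_rpow_const (by linarith))
  obtain ⟨C, -, hC⟩ := hh.exists_bound_comp hcont
  have := hh.integral_mul_layerKernel_swap hR (c := fun s => m * h s ^ (m - 1)) (C := C)
    (Ψ := fun _ => 1) (S := 1) (hh.aestronglyMeasurable_comp hcont)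
    (fun s hs => hC s (Ioo_subset_Icc_self hs)) measurable_const (by simp)
  rw [← integral_const_mul]
  calc _ = _ := by
        refine integral_congr_ae ?_
        filter_upwards [compl_mem_ae_iff.2 (measure_singleton (0 : ℝ))] with x hx
        have := hh.comp_ofHFun hR (φ := fun y => y ^ m)
          (fun y => Real.hasDerivAt_rpow_const (Or.inr (by linarith))) hcont hx
        rw [Real.zero_rpow (by linarith), sub_zero] at this
        rw [this]
        exact (mul_one _).symm
    _ = _ := this
    _ = _ := by
        refine integral_congr_ae ?_
        filter_upwards [ae_restrict_mem measurableSet_Ioo] with s hs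
        have hp := hh.rightSlope_pos hR hs
        rw [intervalIntegral.integral_const, sub_neg_eq_add, add_halves, smul_eq_mul, mul_one,
          mul_one_div_cancel hp.ne', mul_one]

/-- The interaction energy in height variables: the pair energy of the level intervals, summed
over all pairs of levels. -/
theorem integral_interaction (hh : IsHeightProfile R h) (hR : 0 < R) {W : ℝ → ℝ}
    (hW : Continuous W) (he : ∀ x, W (-x) = W x) :
    ∫ x, (∫ y, W (x - y) * ofHFun h y) * ofHFun h x =
      ∫ s, ∫ r, pairEnergy W (rightSlope h s) (rightSlope h r) ∂unitVolume ∂unitVolume := by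
  obtain ⟨S, hS⟩ := isCompact_Icc.exists_bound_of_continuousOn (s := Icc (-(2 * R)) (2 * R))
    hW.continuousOn
  simp only [Real.norm_eq_abs] at hS
  set g : ℝ → ℝ → ℝ := fun x r => rightSlope h r *
    (prim W (x + 1 / rightSlope h r / 2) - prim W (x - 1 / rightSlope h r / 2)) with hg
  have hgm : Measurable fun z : ℝ × ℝ => g z.1 z.2 := by
    have h1 := measurable_rightSlope h
    have h2 := (continuous_prim hW).measurable
    have h3 : Measurable fun z : ℝ × ℝ => rightSlope h z.2 := h1.comp measurable_snd
    exact h3.mul ((h2.comp (by fun_prop)).sub (h2.comp (by fun_prop)))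
  have hgb : ∀ x ∈ Icc (-R) R, ∀ r ∈ Ioo (0 : ℝ) 1, |g x r| ≤ S := by
    intro x hx r hr
    have hp := hh.rightSlope_pos hR hr
    have hle := hh.one_div_rightSlope_le hR hr
    have hb : 0 < 1 / rightSlope h r := one_div_pos.2 hp
    have := abs_prim_sub_le hW hS (x := x + 1 / rightSlope h r / 2)
      (y := x - 1 / rightSlope h r / 2) ⟨by linarith [hx.1], by linarith [hx.2]⟩
      ⟨by linarith [hx.1], by linarith [hx.2]⟩
    rw [add_sub_sub_cancel, add_halves, abs_of_pos hb] at this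
    rw [hg, abs_mul, abs_of_pos hp]
    calc _ ≤ rightSlope h r * (S * (1 / rightSlope h r)) := by gcongr
      _ = S := by field_simp
  have hinner : ∀ x, ∫ y, W (x - y) * ofHFun h y = ∫ r, g x r ∂unitVolume := by
    intro x
    obtain ⟨S', hS'⟩ := isCompact_Icc.exists_bound_of_continuousOn (s := Icc (-R) R)
      (f := fun y => W (x - y)) (by fun_prop)
    rw [hh.integral_ofHFun_mul hR (Ψ := fun y => W (x - y)) (by fun_prop) hS']
    congr 1; ext r
    rw [intervalIntegral.integral_comp_sub_left W x, integral_eq_prim_sub hW, sub_neg_eq_add]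
  simp only [hinner]
  have hwm : Measurable fun x => ∫ r, g x r ∂unitVolume :=
    (hgm.stronglyMeasurable.integral_prod_right' (ν := unitVolume)).measurable
  have hwb : ∀ x ∈ Icc (-R) R, |∫ r, g x r ∂unitVolume| ≤ S := by
    intro x hx
    have := norm_integral_le_of_norm_le_const (μ := unitVolume) (f := g x) (C := S) (by
      filter_upwards [ae_restrict_mem measurableSet_Ioo] with r hr using hgb x hx r hr)
    simpa [Real.volume_real_Ioo] using this
  rw [hh.integral_ofHFun_mul hR hwm hwb]
  refine integral_congr_ae ?_
  filter_upwards [ae_restrict_mem measurableSet_Ioo] with s hs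
  have hp := hh.rightSlope_pos hR hs
  have hle := hh.one_div_rightSlope_le hR hs
  have ha : 0 < 1 / rightSlope h s := one_div_pos.2 hp
  have hneg : -(1 / rightSlope h s / 2) ≤ 1 / rightSlope h s / 2 := by linarith
  rw [intervalIntegral.integral_of_le hneg, integral_integral_swap, ← integral_const_mul]
  · refine integral_congr_ae ?_
    filter_upwards [ae_restrict_mem measurableSet_Ioo] with r hr
    have hq := hh.rightSlope_pos hR hr
    rw [← intervalIntegral.integral_of_le hneg, pairEnergy_eq_secondPrim W hp.ne' hq.ne']
    simp only [hg]
    have hK := continuous_prim hW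
    have hV : ∀ d x, HasDerivAt (fun x => secondPrim W (x + d)) (prim W (x + d)) x :=
      fun d x => (hasDerivAt_secondPrim hW (x + d)).comp_add_const x d
    have hder : ∀ x ∈ uIcc (-(1 / rightSlope h s / 2)) (1 / rightSlope h s / 2),
        HasDerivAt (fun x => secondPrim W (x + 1 / rightSlope h r / 2) -
          secondPrim W (x + -(1 / rightSlope h r / 2)))
        (prim W (x + 1 / rightSlope h r / 2) - prim W (x - 1 / rightSlope h r / 2)) x :=
      fun x _ => (hV _ x).sub (hV _ x)
    rw [intervalIntegral.integral_const_mul, intervalIntegral.integral_eq_sub_of_hasDerivAt hder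
      (Continuous.intervalIntegrable (by fun_prop) _ _)]
    generalize 1 / rightSlope h s = a
    generalize 1 / rightSlope h r = b
    rw [show a / 2 + b / 2 = (a + b) / 2 by ring, show a / 2 + -(b / 2) = (a - b) / 2 by ring,
      show -(a / 2) + b / 2 = -((a - b) / 2) by ring,
      show -(a / 2) + -(b / 2) = -((a + b) / 2) by ring, secondPrim_neg he, secondPrim_neg he]
    ring
  · refine Integrable.of_bound hgm.aestronglyMeasurable S ?_
    rw [Measure.prod_restrict]
    filter_upwards [ae_restrict_mem (measurableSet_Ioc.prod measurableSet_Ioo)] with z hz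
    exact hgb z.1 ⟨by linarith [hz.1.1], by linarith [hz.1.2]⟩ z.2 hz.2

end IsHeightProfile

/-! ### Differentiation along the interpolation -/

theorem hasDerivAt_integral_of_bounded {α : Type*} [MeasurableSpace α] {ν : Measure α}
    [IsFiniteMeasure ν] {F F' : ℝ → α → ℝ}
    (hF : ∀ t ∈ Ioo (0 : ℝ) 1, AEStronglyMeasurable (F t) ν)
    (hF' : ∀ t ∈ Ioo (0 : ℝ) 1, AEStronglyMeasurable (F' t) ν)
    (hb : ∀ δ > 0, ∃ C, ∀ᵐ a ∂ν, ∀ t ∈ Icc δ (1 - δ), |F t a| ≤ C)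
    (hb' : ∀ δ > 0, ∃ C, ∀ᵐ a ∂ν, ∀ t ∈ Icc δ (1 - δ), |F' t a| ≤ C)
    (hd : ∀ᵐ a ∂ν, ∀ t ∈ Ioo (0 : ℝ) 1, HasDerivAt (F · a) (F' t a) t)
    {t : ℝ} (ht : t ∈ Ioo (0 : ℝ) 1) :
    Integrable (F' t) ν ∧ HasDerivAt (fun τ => ∫ a, F τ a ∂ν) (∫ a, F' t a ∂ν) t := by
  set δ := min t (1 - t) / 2 with hδ
  have h1 : min t (1 - t) ≤ t := min_le_left _ _
  have h2 : min t (1 - t) ≤ 1 - t := min_le_right _ _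
  have h0 : 0 < min t (1 - t) := lt_min ht.1 (sub_pos.2 ht.2)
  have hδ0 : 0 < δ := by positivity
  have htδ : Icc δ (1 - δ) ∈ 𝓝 t := Icc_mem_nhds (by linarith) (by linarith)
  have hsub : Icc δ (1 - δ) ⊆ Ioo (0 : ℝ) 1 := fun x hx =>
    ⟨hδ0.trans_le hx.1, hx.2.trans_lt (by linarith)⟩
  obtain ⟨C, hC⟩ := hb δ hδ0
  obtain ⟨C', hC'⟩ := hb' δ hδ0
  refine hasDerivAt_integral_of_dominated_loc_of_deriv_le (bound := fun _ => C') htδ ?_ ?_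
    (hF' t ht) hC' (integrable_const _) ?_
  · filter_upwards [isOpen_Ioo.mem_nhds ht] with τ hτ using hF τ hτ
  · refine Integrable.of_bound (hF t ht) C ?_
    filter_upwards [hC] with a ha using ha t (mem_of_mem_nhds htδ)
  · filter_upwards [hd] with a ha τ hτ using ha τ (hsub hτ)

theorem hasDerivAt_segment (a b t : ℝ) :
    HasDerivAt (fun τ : ℝ => (1 - τ) * a + τ * b) (b - a) t := by
  have := (((hasDerivAt_id t).const_sub 1).mul_const a).fun_add ((hasDerivAt_id t).mul_const b)
  exact this.congr_deriv (by ring)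

theorem segment_pos {a b t : ℝ} (ha : 0 < a) (hb : 0 < b) (ht : t ∈ Icc (0 : ℝ) 1) :
    0 < (1 - t) * a + t * b := by
  rcases ht.1.eq_or_lt with rfl | h
  · simpa using ha
  · have : 0 ≤ (1 - t) * a := mul_nonneg (sub_nonneg.2 ht.2) ha.le
    have : 0 < t * b := mul_pos h hb
    linarith

/-- Away from the end points, the velocity of a segment of positive numbers is controlled by its
position. -/
theorem abs_velocity_div_segment_le {a b t δ : ℝ} (ha : 0 < a) (hb : 0 < b) (hδ : 0 < δ)
    (ht : t ∈ Icc δ (1 - δ)) : |(b - a) / ((1 - t) * a + t * b)| ≤ 1 / δ := by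
  have h1 : δ * a ≤ (1 - t) * a := mul_le_mul_of_nonneg_right (by linarith [ht.2]) ha.le
  have h2 : δ * b ≤ t * b := mul_le_mul_of_nonneg_right ht.1 hb.le
  have h3 := mul_pos hδ ha
  have h4 := mul_pos hδ hb
  have hpos : 0 < (1 - t) * a + t * b := by linarith
  rw [abs_div, abs_of_pos hpos, div_le_div_iff₀ hpos hδ, one_mul, mul_comm]
  rcases abs_choice (b - a) with h | h <;> rw [h] <;> nlinarith

section curve

variable {R m : ℝ} {h₀ h₁ : ℝ → ℝ}

/-- The slope `(1 - t) h₀' + t h₁'` of the interpolated height function. -/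
def slopeSegment (h₀ h₁ : ℝ → ℝ) (t s : ℝ) : ℝ :=
  (1 - t) * rightSlope h₀ s + t * rightSlope h₁ s

/-- The velocity `h₁' - h₀'` of the slope along the interpolation. -/
def slopeVelocity (h₀ h₁ : ℝ → ℝ) (s : ℝ) : ℝ := rightSlope h₁ s - rightSlope h₀ s

theorem measurable_slopeSegment (h₀ h₁ : ℝ → ℝ) (t : ℝ) : Measurable (slopeSegment h₀ h₁ t) :=
  ((measurable_rightSlope h₀).const_mul _).add ((measurable_rightSlope h₁).const_mul _)

theorem measurable_slopeVelocity (h₀ h₁ : ℝ → ℝ) : Measurable (slopeVelocity h₀ h₁) :=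
  (measurable_rightSlope h₁).sub (measurable_rightSlope h₀)

theorem IsHeightProfile.slopeSegment_pos (hh₀ : IsHeightProfile R h₀) (hh₁ : IsHeightProfile R h₁)
    (hR : 0 < R) {s t : ℝ} (hs : s ∈ Ioo (0 : ℝ) 1) (ht : t ∈ Icc (0 : ℝ) 1) :
    0 < slopeSegment h₀ h₁ t s :=
  segment_pos (hh₀.rightSlope_pos hR hs) (hh₁.rightSlope_pos hR hs) ht

theorem IsHeightProfile.one_div_slopeSegment_le (hh₀ : IsHeightProfile R h₀)
    (hh₁ : IsHeightProfile R h₁) (hR : 0 < R) {s t : ℝ} (hs : s ∈ Ioo (0 : ℝ) 1)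
    (ht : t ∈ Icc (0 : ℝ) 1) : 1 / slopeSegment h₀ h₁ t s ≤ 2 * R := by
  rw [slopeSegment, ← hh₀.rightSlope_combination hh₁ t hs]
  exact (hh₀.combination hh₁ ht).one_div_rightSlope_le hR hs

theorem IsHeightProfile.abs_slopeVelocity_div_le (hh₀ : IsHeightProfile R h₀)
    (hh₁ : IsHeightProfile R h₁) (hR : 0 < R) {s t δ : ℝ} (hs : s ∈ Ioo (0 : ℝ) 1) (hδ : 0 < δ)
    (ht : t ∈ Icc δ (1 - δ)) : |slopeVelocity h₀ h₁ s / slopeSegment h₀ h₁ t s| ≤ 1 / δ :=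
  abs_velocity_div_segment_le (hh₀.rightSlope_pos hR hs) (hh₁.rightSlope_pos hR hs) hδ ht

theorem mem_unit_of_mem_shrunk {δ t : ℝ} (hδ : 0 < δ) (ht : t ∈ Icc δ (1 - δ)) : t ∈ Icc (0 : ℝ) 1 :=
  ⟨hδ.le.trans ht.1, by linarith [ht.2]⟩

/-- Integrand of the internal energy in height variables. -/
def powerIntegrand (m : ℝ) (h₀ h₁ : ℝ → ℝ) (t s : ℝ) : ℝ :=
  ((1 - t) * h₀ s + t * h₁ s) ^ (m - 1)

/-- First `t`-derivative of `powerIntegrand`. -/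
def powerIntegrandD (m : ℝ) (h₀ h₁ : ℝ → ℝ) (t s : ℝ) : ℝ :=
  (h₁ s - h₀ s) * (m - 1) * ((1 - t) * h₀ s + t * h₁ s) ^ (m - 1 - 1)

/-- Second `t`-derivative of `powerIntegrand`. -/
def powerIntegrandD2 (m : ℝ) (h₀ h₁ : ℝ → ℝ) (t s : ℝ) : ℝ :=
  (h₁ s - h₀ s) * (m - 1) *
    ((h₁ s - h₀ s) * (m - 1 - 1) * ((1 - t) * h₀ s + t * h₁ s) ^ (m - 1 - 1 - 1))

theorem IsHeightProfile.aemeasurable (hh : IsHeightProfile R h₀) : AEMeasurable h₀ unitVolume :=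
  (hh.aestronglyMeasurable_comp continuous_id).aemeasurable

theorem IsHeightProfile.exists_powerIntegrand_bound (hh₀ : IsHeightProfile R h₀)
    (hh₁ : IsHeightProfile R h₁) (hR : 0 < R) (hm : 2 ≤ m) :
    ∃ B, 0 ≤ B ∧ ∀ s ∈ Ioo (0 : ℝ) 1, ∀ t ∈ Icc (0 : ℝ) 1, |powerIntegrand m h₀ h₁ t s| ≤ B := by
  refine ⟨(max (h₀ 1) (h₁ 1)) ^ (m - 1),
    Real.rpow_nonneg (le_max_of_le_left (hh₀.pos hR one_pos le_rfl).le) _, fun s hs t ht => ?_⟩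
  have hpos := segment_pos (hh₀.pos hR hs.1 hs.2.le) (hh₁.pos hR hs.1 hs.2.le) ht
  rw [powerIntegrand, abs_of_nonneg (Real.rpow_nonneg hpos.le _)]
  refine Real.rpow_le_rpow hpos.le ?_ (by linarith)
  have hs' := Ioo_subset_Icc_self hs
  have h1 : (1 : ℝ) ∈ Icc (0 : ℝ) 1 := right_mem_Icc.2 zero_le_one
  have k0 := (hh₀.monotoneOn hR hs' h1 hs.2.le).trans (le_max_left _ (h₁ 1))
  have k1 := (hh₁.monotoneOn hR hs' h1 hs.2.le).trans (le_max_right (h₀ 1) _)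
  calc _ ≤ (1 - t) * max (h₀ 1) (h₁ 1) + t * max (h₀ 1) (h₁ 1) :=
        add_le_add (mul_le_mul_of_nonneg_left k0 (sub_nonneg.2 ht.2))
          (mul_le_mul_of_nonneg_left k1 ht.1)
    _ = _ := by ring

theorem IsHeightProfile.continuousOn_integral_power (hh₀ : IsHeightProfile R h₀)
    (hh₁ : IsHeightProfile R h₁) (hR : 0 < R) (hm : 2 ≤ m) :
    ContinuousOn (fun t => ∫ s, powerIntegrand m h₀ h₁ t s ∂unitVolume) (Icc 0 1) := by
  obtain ⟨B, -, hB⟩ := hh₀.exists_powerIntegrand_bound hh₁ hR hm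
  have m0 := IsHeightProfile.aemeasurable hh₀
  have m1 := IsHeightProfile.aemeasurable hh₁
  refine continuousOn_of_dominated (bound := fun _ => B) (fun t _ => ?_) (fun t ht => ?_)
    (integrable_const _) (ae_of_all _ fun s => ?_)
  · exact (((m0.const_mul _).add (m1.const_mul _)).pow_const _).aestronglyMeasurable
  · filter_upwards [ae_restrict_mem measurableSet_Ioo] with s hs using hB s hs t ht
  · exact Continuous.continuousOn (Continuous.rpow_const (by fun_prop)
      fun _ => Or.inr (by linarith))

theorem IsHeightProfile.hasDerivAt_integral_power (hh₀ : IsHeightProfile R h₀)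
    (hh₁ : IsHeightProfile R h₁) (hR : 0 < R) (hm : 2 ≤ m) {t : ℝ} (ht : t ∈ Ioo (0 : ℝ) 1) :
    HasDerivAt (fun τ => ∫ s, powerIntegrand m h₀ h₁ τ s ∂unitVolume)
      (∫ s, powerIntegrandD m h₀ h₁ t s ∂unitVolume) t ∧
    HasDerivAt (fun τ => ∫ s, powerIntegrandD m h₀ h₁ τ s ∂unitVolume)
      (∫ s, powerIntegrandD2 m h₀ h₁ t s ∂unitVolume) t := by
  obtain ⟨B, hB0, hB⟩ := hh₀.exists_powerIntegrand_bound hh₁ hR hm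
  have m0 := IsHeightProfile.aemeasurable hh₀
  have m1 := IsHeightProfile.aemeasurable hh₁
  have mseg : ∀ (t e : ℝ),
      AEMeasurable (fun s => ((1 - t) * h₀ s + t * h₁ s) ^ e) unitVolume :=
    fun t e => ((m0.const_mul _).add (m1.const_mul _)).pow_const _
  have hM : ∀ t, AEStronglyMeasurable (powerIntegrand m h₀ h₁ t) unitVolume :=
    fun t => (mseg t _).aestronglyMeasurable
  have hM1 : ∀ t, AEStronglyMeasurable (powerIntegrandD m h₀ h₁ t) unitVolume :=
    fun t => (((m1.sub m0).mul_const _).mul (mseg t _)).aestronglyMeasurable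
  have hM2 : ∀ t, AEStronglyMeasurable (powerIntegrandD2 m h₀ h₁ t) unitVolume :=
    fun t => (((m1.sub m0).mul_const _).mul
      (((m1.sub m0).mul_const _).mul (mseg t _))).aestronglyMeasurable
  have hpos : ∀ s ∈ Ioo (0 : ℝ) 1, ∀ t ∈ Icc (0 : ℝ) 1, 0 < (1 - t) * h₀ s + t * h₁ s :=
    fun s hs t ht => segment_pos (hh₀.pos hR hs.1 hs.2.le) (hh₁.pos hR hs.1 hs.2.le) ht
  have hb : ∀ δ > 0, ∃ C, ∀ᵐ s ∂unitVolume, ∀ t ∈ Icc δ (1 - δ),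
      |powerIntegrand m h₀ h₁ t s| ≤ C := fun δ hδ => ⟨B, by
    filter_upwards [ae_restrict_mem measurableSet_Ioo] with s hs t ht
    exact hB s hs t (mem_unit_of_mem_shrunk hδ ht)⟩
  have hb1 : ∀ δ > 0, ∃ C, ∀ᵐ s ∂unitVolume, ∀ t ∈ Icc δ (1 - δ),
      |powerIntegrandD m h₀ h₁ t s| ≤ C := fun δ hδ => ⟨(m - 1) * B * (1 / δ), by
    filter_upwards [ae_restrict_mem measurableSet_Ioo] with s hs t ht
    have hp := hpos s hs t (mem_unit_of_mem_shrunk hδ ht)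
    have hv := abs_velocity_div_segment_le (hh₀.pos hR hs.1 hs.2.le)
      (hh₁.pos hR hs.1 hs.2.le) hδ ht
    have e : powerIntegrandD m h₀ h₁ t s = (m - 1) * powerIntegrand m h₀ h₁ t s *
        ((h₁ s - h₀ s) / ((1 - t) * h₀ s + t * h₁ s)) := by
      rw [powerIntegrandD, powerIntegrand, Real.rpow_sub_one hp.ne' (m - 1)]
      field_simp
    have hm1 : 0 ≤ m - 1 := by linarith
    rw [e, abs_mul, abs_mul, abs_of_nonneg hm1]
    have := hB s hs t (mem_unit_of_mem_shrunk hδ ht)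
    gcongr⟩
  have hb2 : ∀ δ > 0, ∃ C, ∀ᵐ s ∂unitVolume, ∀ t ∈ Icc δ (1 - δ),
      |powerIntegrandD2 m h₀ h₁ t s| ≤ C := fun δ hδ =>
    ⟨(m - 1) * (m - 1 - 1) * B * (1 / δ) ^ 2, by
    filter_upwards [ae_restrict_mem measurableSet_Ioo] with s hs t ht
    have hp := hpos s hs t (mem_unit_of_mem_shrunk hδ ht)
    have hv := abs_velocity_div_segment_le (hh₀.pos hR hs.1 hs.2.le)
      (hh₁.pos hR hs.1 hs.2.le) hδ ht
    have e : powerIntegrandD2 m h₀ h₁ t s = (m - 1) * (m - 1 - 1) * powerIntegrand m h₀ h₁ t s *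
        ((h₁ s - h₀ s) / ((1 - t) * h₀ s + t * h₁ s)) ^ 2 := by
      rw [powerIntegrandD2, powerIntegrand, Real.rpow_sub_one hp.ne' (m - 1 - 1),
        Real.rpow_sub_one hp.ne' (m - 1)]
      field_simp
    have hm1 : 0 ≤ m - 1 := by linarith
    have hm2 : 0 ≤ m - 1 - 1 := by linarith
    rw [e, abs_mul, abs_mul, abs_of_nonneg (mul_nonneg hm1 hm2), abs_pow]
    have := hB s hs t (mem_unit_of_mem_shrunk hδ ht)
    gcongr⟩
  refine ⟨(hasDerivAt_integral_of_bounded (fun t _ => hM t) (fun t _ => hM1 t) hb hb1 ?_ ht).2,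
    (hasDerivAt_integral_of_bounded (fun t _ => hM1 t) (fun t _ => hM2 t) hb1 hb2 ?_ ht).2⟩
  · filter_upwards [ae_restrict_mem measurableSet_Ioo] with s hs t ht
    have hp := hpos s hs t (Ioo_subset_Icc_self ht)
    exact (hasDerivAt_segment (h₀ s) (h₁ s) t).rpow_const (Or.inl hp.ne')
  · filter_upwards [ae_restrict_mem measurableSet_Ioo] with s hs t ht
    have hp := hpos s hs t (Ioo_subset_Icc_self ht)
    exact ((hasDerivAt_segment (h₀ s) (h₁ s) t).rpow_const (Or.inl hp.ne')).const_mul _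

theorem IsHeightProfile.integral_powerIntegrandD2_nonneg (hh₀ : IsHeightProfile R h₀)
    (hh₁ : IsHeightProfile R h₁) (hR : 0 < R) (hm : 2 ≤ m) {t : ℝ} (ht : t ∈ Ioo (0 : ℝ) 1) :
    0 ≤ ∫ s, powerIntegrandD2 m h₀ h₁ t s ∂unitVolume := by
  refine integral_nonneg_of_ae ?_
  filter_upwards [ae_restrict_mem measurableSet_Ioo] with s hs
  have hp := segment_pos (hh₀.pos hR hs.1 hs.2.le) (hh₁.pos hR hs.1 hs.2.le)
    (Ioo_subset_Icc_self ht)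
  have e : powerIntegrandD2 m h₀ h₁ t s = (m - 1) * (m - 1 - 1) * (h₁ s - h₀ s) ^ 2 *
      ((1 - t) * h₀ s + t * h₁ s) ^ (m - 1 - 1 - 1) := by
    rw [powerIntegrandD2]; ring
  rw [e]
  exact mul_nonneg (mul_nonneg (mul_nonneg (by linarith) (by linarith)) (sq_nonneg _))
    (Real.rpow_nonneg hp.le _)

variable {lam L : ℝ} {W : ℝ → ℝ}

theorem ae_unitVolume_prod :
    ∀ᵐ z ∂unitVolume.prod unitVolume, z.1 ∈ Ioo (0 : ℝ) 1 ∧ z.2 ∈ Ioo (0 : ℝ) 1 := by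
  rw [Measure.prod_restrict]
  filter_upwards [ae_restrict_mem (measurableSet_Ioo.prod measurableSet_Ioo)] with z hz using hz

theorem HasSlopeBounds.exists_bound (hW : HasSlopeBounds lam L (2 * R) W) :
    ∃ S, ∀ z ∈ Icc (-(2 * R)) (2 * R), |W z| ≤ S :=
  isCompact_Icc.exists_bound_of_continuousOn hW.continuous.continuousOn

section measurability

variable {α : Type*} [MeasurableSpace α] {p q p' q' : α → ℝ}

theorem measurable_pairEnergy (hW : Continuous W) (hp : Measurable p) (hq : Measurable q) :
    Measurable fun z => pairEnergy W (p z) (q z) := by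
  have hK := (continuous_prim hW).measurable
  have hJ := (continuous_momentPrim hW).measurable
  unfold pairEnergy
  fun_prop

theorem measurable_pairEnergyD (hW : Continuous W) (hp : Measurable p) (hq : Measurable q)
    (hp' : Measurable p') (hq' : Measurable q') :
    Measurable fun z => pairEnergyD W (p z) (q z) (p' z) (q' z) := by
  have hK := (continuous_prim hW).measurable
  have hJ := (continuous_momentPrim hW).measurable
  unfold pairEnergyD
  fun_prop

theorem measurable_pairEnergyD2 (hW : Continuous W) (hp : Measurable p) (hq : Measurable q)
    (hp' : Measurable p') (hq' : Measurable q') :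
    Measurable fun z => pairEnergyD2 W (p z) (q z) (p' z) (q' z) := by
  have hWm := hW.measurable
  have hJ := (continuous_momentPrim hW).measurable
  unfold pairEnergyD2
  fun_prop

end measurability

/-- The pair energy of the levels `z.1`, `z.2` at time `t`. -/
def pairIntegrand (W h₀ h₁ : ℝ → ℝ) (t : ℝ) (z : ℝ × ℝ) : ℝ :=
  pairEnergy W (slopeSegment h₀ h₁ t z.1) (slopeSegment h₀ h₁ t z.2)

/-- First `t`-derivative of `pairIntegrand`. -/
def pairIntegrandD (W h₀ h₁ : ℝ → ℝ) (t : ℝ) (z : ℝ × ℝ) : ℝ :=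
  pairEnergyD W (slopeSegment h₀ h₁ t z.1) (slopeSegment h₀ h₁ t z.2)
    (slopeVelocity h₀ h₁ z.1) (slopeVelocity h₀ h₁ z.2)

/-- Second `t`-derivative of `pairIntegrand`. -/
def pairIntegrandD2 (W h₀ h₁ : ℝ → ℝ) (t : ℝ) (z : ℝ × ℝ) : ℝ :=
  pairEnergyD2 W (slopeSegment h₀ h₁ t z.1) (slopeSegment h₀ h₁ t z.2)
    (slopeVelocity h₀ h₁ z.1) (slopeVelocity h₀ h₁ z.2)

theorem measurable_pairIntegrand (hW : Continuous W) (h₀ h₁ : ℝ → ℝ) (t : ℝ) :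
    Measurable (pairIntegrand W h₀ h₁ t) :=
  measurable_pairEnergy hW ((measurable_slopeSegment h₀ h₁ t).comp measurable_fst)
    ((measurable_slopeSegment h₀ h₁ t).comp measurable_snd)

theorem measurable_pairIntegrandD (hW : Continuous W) (h₀ h₁ : ℝ → ℝ) (t : ℝ) :
    Measurable (pairIntegrandD W h₀ h₁ t) :=
  measurable_pairEnergyD hW ((measurable_slopeSegment h₀ h₁ t).comp measurable_fst)
    ((measurable_slopeSegment h₀ h₁ t).comp measurable_snd)
    ((measurable_slopeVelocity h₀ h₁).comp measurable_fst)
    ((measurable_slopeVelocity h₀ h₁).comp measurable_snd)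

theorem measurable_pairIntegrandD2 (hW : Continuous W) (h₀ h₁ : ℝ → ℝ) (t : ℝ) :
    Measurable (pairIntegrandD2 W h₀ h₁ t) :=
  measurable_pairEnergyD2 hW ((measurable_slopeSegment h₀ h₁ t).comp measurable_fst)
    ((measurable_slopeSegment h₀ h₁ t).comp measurable_snd)
    ((measurable_slopeVelocity h₀ h₁).comp measurable_fst)
    ((measurable_slopeVelocity h₀ h₁).comp measurable_snd)

theorem IsHeightProfile.exists_pairIntegrand_bound (hh₀ : IsHeightProfile R h₀)
    (hh₁ : IsHeightProfile R h₁) (hR : 0 < R) (hW : HasSlopeBounds lam L (2 * R) W)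
    (hl : 0 ≤ lam) : ∃ C, ∀ᵐ z ∂unitVolume.prod unitVolume, ∀ t ∈ Icc (0 : ℝ) 1,
      |pairIntegrand W h₀ h₁ t z| ≤ C := by
  obtain ⟨S, hS⟩ := hW.exists_bound
  refine ⟨3 * S, ?_⟩
  filter_upwards [ae_unitVolume_prod] with z hz t ht
  exact hW.abs_pairEnergy_le hl hS (hh₀.slopeSegment_pos hh₁ hR hz.1 ht)
    (hh₀.slopeSegment_pos hh₁ hR hz.2 ht) (hh₀.one_div_slopeSegment_le hh₁ hR hz.1 ht)
    (hh₀.one_div_slopeSegment_le hh₁ hR hz.2 ht)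

theorem IsHeightProfile.hasDerivAt_pairIntegrand (hh₀ : IsHeightProfile R h₀)
    (hh₁ : IsHeightProfile R h₁) (hR : 0 < R) (hW : Continuous W) {z : ℝ × ℝ}
    (hz : z.1 ∈ Ioo (0 : ℝ) 1 ∧ z.2 ∈ Ioo (0 : ℝ) 1) {t : ℝ} (ht : t ∈ Icc (0 : ℝ) 1) :
    HasDerivAt (pairIntegrand W h₀ h₁ · z) (pairIntegrandD W h₀ h₁ t z) t :=
  hasDerivAt_pairEnergy hW (hasDerivAt_segment _ _ t) (hasDerivAt_segment _ _ t)
    (hh₀.slopeSegment_pos hh₁ hR hz.1 ht).ne' (hh₀.slopeSegment_pos hh₁ hR hz.2 ht).ne'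

theorem IsHeightProfile.hasDerivAt_pairIntegrandD (hh₀ : IsHeightProfile R h₀)
    (hh₁ : IsHeightProfile R h₁) (hR : 0 < R) (hW : Continuous W) {z : ℝ × ℝ}
    (hz : z.1 ∈ Ioo (0 : ℝ) 1 ∧ z.2 ∈ Ioo (0 : ℝ) 1) {t : ℝ} (ht : t ∈ Icc (0 : ℝ) 1) :
    HasDerivAt (pairIntegrandD W h₀ h₁ · z) (pairIntegrandD2 W h₀ h₁ t z) t :=
  hasDerivAt_pairEnergyD hW (hasDerivAt_segment _ _ t) (hasDerivAt_segment _ _ t)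
    (hh₀.slopeSegment_pos hh₁ hR hz.1 ht).ne' (hh₀.slopeSegment_pos hh₁ hR hz.2 ht).ne'

theorem IsHeightProfile.continuousOn_integral_pair (hh₀ : IsHeightProfile R h₀)
    (hh₁ : IsHeightProfile R h₁) (hR : 0 < R) (hW : HasSlopeBounds lam L (2 * R) W)
    (hl : 0 ≤ lam) :
    ContinuousOn (fun t => ∫ z, pairIntegrand W h₀ h₁ t z ∂unitVolume.prod unitVolume)
      (Icc 0 1) := by
  obtain ⟨C, hC⟩ := hh₀.exists_pairIntegrand_bound hh₁ hR hW hl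
  refine continuousOn_of_dominated (bound := fun _ => C)
    (fun t _ => (measurable_pairIntegrand hW.continuous h₀ h₁ t).aestronglyMeasurable)
    (fun t ht => ?_) (integrable_const _) ?_
  · filter_upwards [hC] with z hz using hz t ht
  · filter_upwards [ae_unitVolume_prod] with z hz t ht
    exact (hh₀.hasDerivAt_pairIntegrand hh₁ hR hW.continuous hz ht).continuousAt.continuousWithinAt

theorem IsHeightProfile.hasDerivAt_integral_pair (hh₀ : IsHeightProfile R h₀)
    (hh₁ : IsHeightProfile R h₁) (hR : 0 < R) (hW : HasSlopeBounds lam L (2 * R) W)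
    (hl : 0 ≤ lam) {t : ℝ} (ht : t ∈ Ioo (0 : ℝ) 1) :
    HasDerivAt (fun τ => ∫ z, pairIntegrand W h₀ h₁ τ z ∂unitVolume.prod unitVolume)
      (∫ z, pairIntegrandD W h₀ h₁ t z ∂unitVolume.prod unitVolume) t ∧
    HasDerivAt (fun τ => ∫ z, pairIntegrandD W h₀ h₁ τ z ∂unitVolume.prod unitVolume)
      (∫ z, pairIntegrandD2 W h₀ h₁ t z ∂unitVolume.prod unitVolume) t ∧
    Integrable (pairIntegrandD2 W h₀ h₁ t) (unitVolume.prod unitVolume) := by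
  have hc := hW.continuous
  obtain ⟨S, hS⟩ := hW.exists_bound
  have hM := fun t => (measurable_pairIntegrand hc h₀ h₁ t).aestronglyMeasurable
    (μ := unitVolume.prod unitVolume)
  have hM1 := fun t => (measurable_pairIntegrandD hc h₀ h₁ t).aestronglyMeasurable
    (μ := unitVolume.prod unitVolume)
  have hM2 := fun t => (measurable_pairIntegrandD2 hc h₀ h₁ t).aestronglyMeasurable
    (μ := unitVolume.prod unitVolume)
  have hb : ∀ δ > 0, ∃ C, ∀ᵐ z ∂unitVolume.prod unitVolume, ∀ t ∈ Icc δ (1 - δ),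
      |pairIntegrand W h₀ h₁ t z| ≤ C := by
    intro δ hδ
    obtain ⟨C, hC⟩ := hh₀.exists_pairIntegrand_bound hh₁ hR hW hl
    exact ⟨C, hC.mono fun z hz t ht => hz t (mem_unit_of_mem_shrunk hδ ht)⟩
  have hb1 : ∀ δ > 0, ∃ C, ∀ᵐ z ∂unitVolume.prod unitVolume, ∀ t ∈ Icc δ (1 - δ),
      |pairIntegrandD W h₀ h₁ t z| ≤ C := by
    refine fun δ hδ => ⟨4 * S * (1 / δ), ?_⟩
    filter_upwards [ae_unitVolume_prod] with z hz t ht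
    have ht' := mem_unit_of_mem_shrunk hδ ht
    exact hW.abs_pairEnergyD_le hl hS (hh₀.slopeSegment_pos hh₁ hR hz.1 ht')
      (hh₀.slopeSegment_pos hh₁ hR hz.2 ht') (hh₀.one_div_slopeSegment_le hh₁ hR hz.1 ht')
      (hh₀.one_div_slopeSegment_le hh₁ hR hz.2 ht')
      (hh₀.abs_slopeVelocity_div_le hh₁ hR hz.1 hδ ht)
      (hh₀.abs_slopeVelocity_div_le hh₁ hR hz.2 hδ ht)
  have hb2 : ∀ δ > 0, ∃ C, ∀ᵐ z ∂unitVolume.prod unitVolume, ∀ t ∈ Icc δ (1 - δ),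
      |pairIntegrandD2 W h₀ h₁ t z| ≤ C := by
    refine fun δ hδ => ⟨(2 * L * R + 4 * S) * (1 / δ) ^ 2, ?_⟩
    filter_upwards [ae_unitVolume_prod] with z hz t ht
    have ht' := mem_unit_of_mem_shrunk hδ ht
    exact hW.abs_pairEnergyD2_le hl hS (hh₀.slopeSegment_pos hh₁ hR hz.1 ht')
      (hh₀.slopeSegment_pos hh₁ hR hz.2 ht') (hh₀.one_div_slopeSegment_le hh₁ hR hz.1 ht')
      (hh₀.one_div_slopeSegment_le hh₁ hR hz.2 ht')
      (hh₀.abs_slopeVelocity_div_le hh₁ hR hz.1 hδ ht)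
      (hh₀.abs_slopeVelocity_div_le hh₁ hR hz.2 hδ ht)
  have h1 := hasDerivAt_integral_of_bounded (fun t _ => hM t) (fun t _ => hM1 t) hb hb1
    (ae_unitVolume_prod.mono fun z hz t ht =>
      hh₀.hasDerivAt_pairIntegrand hh₁ hR hc hz (Ioo_subset_Icc_self ht)) ht
  have h2 := hasDerivAt_integral_of_bounded (fun t _ => hM1 t) (fun t _ => hM2 t) hb1 hb2
    (ae_unitVolume_prod.mono fun z hz t ht =>
      hh₀.hasDerivAt_pairIntegrandD hh₁ hR hc hz (Ioo_subset_Icc_self ht)) ht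
  exact ⟨h1.2, h2.2, h2.1⟩

/-- The lower bound's integrand `(∂ₜh')²/(hₜ')⁴`, formed with right derivatives. -/
def slopeRatio (h₀ h₁ : ℝ → ℝ) (t s : ℝ) : ℝ :=
  slopeVelocity h₀ h₁ s ^ 2 / slopeSegment h₀ h₁ t s ^ 4

theorem IsHeightProfile.integrable_slopeRatio (hh₀ : IsHeightProfile R h₀)
    (hh₁ : IsHeightProfile R h₁) (hR : 0 < R) {t : ℝ} (ht : t ∈ Ioo (0 : ℝ) 1) :
    Integrable (slopeRatio h₀ h₁ t) unitVolume := by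
  have hδ : 0 < min t (1 - t) := lt_min ht.1 (sub_pos.2 ht.2)
  have htδ : t ∈ Icc (min t (1 - t)) (1 - min t (1 - t)) :=
    ⟨min_le_left _ _, by linarith [min_le_right t (1 - t)]⟩
  refine Integrable.of_bound (((measurable_slopeVelocity h₀ h₁).pow_const 2).div
    ((measurable_slopeSegment h₀ h₁ t).pow_const 4)).aestronglyMeasurable
    ((1 / min t (1 - t)) ^ 2 * (2 * R) ^ 2) ?_
  filter_upwards [ae_restrict_mem measurableSet_Ioo] with s hs
  have hp := hh₀.slopeSegment_pos hh₁ hR hs (Ioo_subset_Icc_self ht)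
  have h1 := hh₀.one_div_slopeSegment_le hh₁ hR hs (Ioo_subset_Icc_self ht)
  have h2 := hh₀.abs_slopeVelocity_div_le hh₁ hR hs hδ htδ
  have e : slopeRatio h₀ h₁ t s = |slopeVelocity h₀ h₁ s / slopeSegment h₀ h₁ t s| ^ 2 *
      (1 / slopeSegment h₀ h₁ t s) ^ 2 := by
    rw [sq_abs, slopeRatio]; field_simp
  rw [e, Real.norm_of_nonneg (by positivity)]
  gcongr

theorem IsHeightProfile.le_integral_pairIntegrandD2 (hh₀ : IsHeightProfile R h₀)
    (hh₁ : IsHeightProfile R h₁) (hR : 0 < R) (hW : HasSlopeBounds lam L (2 * R) W)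
    (hl : 0 ≤ lam) {t : ℝ} (ht : t ∈ Ioo (0 : ℝ) 1) :
    lam / (3 * R) * ∫ s, slopeRatio h₀ h₁ t s ∂unitVolume ≤
      ∫ z, pairIntegrandD2 W h₀ h₁ t z ∂unitVolume.prod unitVolume := by
  have hT := hh₀.integrable_slopeRatio hh₁ hR ht
  have hone : unitVolume.real univ = 1 := by simp [Real.volume_real_Ioo]
  have e : ∫ z, lam / (6 * R) * (slopeRatio h₀ h₁ t z.1 + slopeRatio h₀ h₁ t z.2)
      ∂unitVolume.prod unitVolume = lam / (3 * R) * ∫ s, slopeRatio h₀ h₁ t s ∂unitVolume := by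
    rw [integral_const_mul, integral_add (hT.comp_fst _) (hT.comp_snd _),
      integral_fun_fst, integral_fun_snd, hone, one_smul]
    field_simp; ring
  rw [← e]
  refine integral_mono_ae (((hT.comp_fst _).add (hT.comp_snd _)).const_mul _)
    (hh₀.hasDerivAt_integral_pair hh₁ hR hW hl ht).2.2 ?_
  filter_upwards [ae_unitVolume_prod] with z hz
  have ht' := Ioo_subset_Icc_self ht
  exact hW.le_pairEnergyD2 hl hR _ _ (hh₀.slopeSegment_pos hh₁ hR hz.1 ht')
      (hh₀.slopeSegment_pos hh₁ hR hz.2 ht') (hh₀.one_div_slopeSegment_le hh₁ hR hz.1 ht')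
      (hh₀.one_div_slopeSegment_le hh₁ hR hz.2 ht')

/-- The energy of the interpolated distribution in height variables. -/
theorem IsHeightProfile.energy_ofHFun_combination (hh₀ : IsHeightProfile R h₀)
    (hh₁ : IsHeightProfile R h₁) (hR : 0 < R) (hW : HasSlopeBounds lam L (2 * R) W)
    (hl : 0 ≤ lam) (hm : 2 ≤ m) {t : ℝ} (ht : t ∈ Icc (0 : ℝ) 1) :
    energy m W (ofHFun fun s => (1 - t) * h₀ s + t * h₁ s) =
      m / (m - 1) * ∫ s, powerIntegrand m h₀ h₁ t s ∂unitVolume +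
      1 / 2 * ∫ z, pairIntegrand W h₀ h₁ t z ∂unitVolume.prod unitVolume := by
  have hh := hh₀.combination hh₁ ht
  obtain ⟨C, hC⟩ := hh₀.exists_pairIntegrand_bound hh₁ hR hW hl
  have hint : Integrable (pairIntegrand W h₀ h₁ t) (unitVolume.prod unitVolume) :=
    Integrable.of_bound (measurable_pairIntegrand hW.continuous h₀ h₁ t).aestronglyMeasurable C
      (hC.mono fun z hz => hz t ht)
  rw [energy, internalEnergy, interactionEnergy, hh.integral_ofHFun_rpow hR hm,
    hh.integral_interaction hR hW.continuous hW.even, integral_prod _ hint]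
  congr 1
  · simp only [powerIntegrand]
    ring
  · congr 1
    refine integral_congr_ae ?_
    filter_upwards [ae_restrict_mem measurableSet_Ioo] with s hs
    refine integral_congr_ae ?_
    filter_upwards [ae_restrict_mem measurableSet_Ioo] with r hr
    rw [hh₀.rightSlope_combination hh₁ t hs, hh₀.rightSlope_combination hh₁ t hr]
    rfl

end curve

theorem powerProfile_le {c a x y : ℝ} (hc : 0 ≤ c) (ha : 0 ≤ a) (hx : 0 ≤ x) (hxy : x ≤ y) :
    powerProfile c a y ≤ powerProfile c a x := by
  rw [powerProfile, powerProfile, abs_of_nonneg hx, abs_of_nonneg (hx.trans hxy)]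
  exact mul_le_mul_of_nonneg_left
    (Real.rpow_le_rpow_of_nonpos (by linarith) (by linarith) (by linarith)) hc

/-- On `[0, A]` the slopes of an attractive potential lie between the lower profile at `A` and the
upper profile at `0`. -/
theorem IsAttractivePotential.hasSlopeBounds {α β cα Cβ : ℝ} {W : ℝ → ℝ}
    (hW : IsAttractivePotential α β cα Cβ W) (A : ℝ) :
    HasSlopeBounds (powerProfile cα α A) Cβ A W := by
  have hdiff : ∀ x, 0 < x → HasDerivAt W (deriv W x) x := fun x hx =>
    (differentiableAt_of_deriv_ne_zero (hW.deriv_pos x hx).ne').hasDerivAt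
  have hα : 0 ≤ α := hW.beta_pos.le.trans hW.beta_le
  have hlin : ∀ c x, HasDerivAt (fun r : ℝ => c * r) c x := fun c x => by
    simpa using (hasDerivAt_id x).const_mul c
  have hc := hW.continuous
  refine ⟨hc, fun x => (hW.symm x).symm, ?_, ?_⟩
  · have hmono : MonotoneOn (fun r => W r - powerProfile cα α A * r) (Icc 0 A) := by
      refine monotoneOn_of_hasDerivWithinAt_nonneg (convex_Icc 0 A) (by fun_prop)
        (f' := fun x => deriv W x - powerProfile cα α A) (fun x hx => ?_) (fun x hx => ?_)
      all_goals rw [interior_Icc] at hx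
      · exact ((hdiff x hx.1).fun_sub (hlin _ x)).hasDerivWithinAt
      · exact sub_nonneg.2 ((powerProfile_le hW.lower_pos.le hα hx.1.le hx.2.le).trans
          (hW.lower x hx.1))
    intro x y hy hyx hx
    have := hmono ⟨hy, hyx.trans hx⟩ ⟨hy.trans hyx, hx⟩ hyx
    simp only at this
    linarith
  · have hmono : MonotoneOn (fun r => Cβ * r - W r) (Icc 0 A) := by
      refine monotoneOn_of_hasDerivWithinAt_nonneg (convex_Icc 0 A) (by fun_prop)
        (f' := fun x => Cβ - deriv W x) (fun x hx => ?_) (fun x hx => ?_)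
      all_goals rw [interior_Icc] at hx
      · exact ((hlin _ x).fun_sub (hdiff x hx.1)).hasDerivWithinAt
      · have h0 := powerProfile_le hW.upper_pos.le hW.beta_pos.le le_rfl hx.1.le
        have h1 : powerProfile Cβ β 0 = Cβ := by simp [powerProfile]
        linarith [hW.upper x hx.1]
    intro x y hy hyx hx
    have := hmono ⟨hy, hyx.trans hx⟩ ⟨hy.trans hyx, hx⟩ hyx
    simp only at this
    linarith

theorem convexityIntegrand_ae_eq {R : ℝ} {ρ₀ ρ₁ : ℝ → ℝ} (hρ₀ : IsRadDecDensity R ρ₀)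
    (hρ₁ : IsRadDecDensity R ρ₁) (t : ℝ) :
    convexityIntegrand ρ₀ ρ₁ t =ᵐ[unitVolume] slopeRatio (hFun ρ₀) (hFun ρ₁) t := by
  have hR := hρ₀.radius_pos
  filter_upwards [hρ₀.isHeightProfile.ae_hasDerivAt hR, hρ₁.isHeightProfile.ae_hasDerivAt hR]
    with s h0 h1
  have hd : deriv (hLinear ρ₀ ρ₁ t) s = slopeSegment (hFun ρ₀) (hFun ρ₁) t s :=
    ((h0.const_mul (1 - t)).fun_add (h1.const_mul t)).deriv
  rw [convexityIntegrand, hd, h0.deriv, h1.deriv]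
  rfl

end AggDiff

end

theorem lemma5p3 (α β cα Cβ m R : ℝ) (W ρ₀ ρ₁ : ℝ → ℝ)
    (hW : AggDiff.IsAttractivePotential α β cα Cβ W) (hm : 2 ≤ m)
    (hρ₀ : AggDiff.IsRadDecDensity R ρ₀) (hρ₁ : AggDiff.IsRadDecDensity R ρ₁) :
    ContinuousOn (AggDiff.curveEnergy m W ρ₀ ρ₁) (Set.Icc 0 1) ∧
    ∀ t ∈ Set.Ioo (0 : ℝ) 1,
      DifferentiableAt ℝ (AggDiff.curveEnergy m W ρ₀ ρ₁) t ∧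
      DifferentiableAt ℝ (deriv (AggDiff.curveEnergy m W ρ₀ ρ₁)) t ∧
      IntervalIntegrable (AggDiff.convexityIntegrand ρ₀ ρ₁ t) MeasureTheory.volume 0 1 ∧
      1 / 32 * (AggDiff.powerProfile cα α (2 * R) / R) *
          ∫ s in (0 : ℝ)..1, AggDiff.convexityIntegrand ρ₀ ρ₁ t s
        ≤ deriv (deriv (AggDiff.curveEnergy m W ρ₀ ρ₁)) t := by
  have hR := hρ₀.radius_pos
  have hh₀ := hρ₀.isHeightProfile
  have hh₁ := hρ₁.isHeightProfile
  have hB := hW.hasSlopeBounds (2 * R)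
  have hl : 0 ≤ AggDiff.powerProfile cα α (2 * R) :=
    mul_nonneg hW.lower_pos.le (Real.rpow_nonneg (by positivity) _)
  have hform : ∀ t ∈ Icc (0 : ℝ) 1, AggDiff.curveEnergy m W ρ₀ ρ₁ t = _ :=
    fun t ht => hh₀.energy_ofHFun_combination hh₁ hR hB hl hm ht
  have hd : ∀ t ∈ Ioo (0 : ℝ) 1, HasDerivAt (AggDiff.curveEnergy m W ρ₀ ρ₁) _ t := fun t ht =>
    (((hh₀.hasDerivAt_integral_power hh₁ hR hm ht).1.const_mul (m / (m - 1))).fun_add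
      ((hh₀.hasDerivAt_integral_pair hh₁ hR hB hl ht).1.const_mul (1 / 2))).congr_of_eventuallyEq
      (by filter_upwards [Icc_mem_nhds ht.1 ht.2] with τ hτ using hform τ hτ)
  refine ⟨ContinuousOn.congr ((continuousOn_const.mul
    (hh₀.continuousOn_integral_power hh₁ hR hm)).add (continuousOn_const.mul
    (hh₀.continuousOn_integral_pair hh₁ hR hB hl))) hform, fun t ht => ?_⟩
  have hd2 : HasDerivAt (deriv (AggDiff.curveEnergy m W ρ₀ ρ₁)) _ t :=
    (((hh₀.hasDerivAt_integral_power hh₁ hR hm ht).2.const_mul (m / (m - 1))).fun_add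
      ((hh₀.hasDerivAt_integral_pair hh₁ hR hB hl ht).2.1.const_mul
        (1 / 2))).congr_of_eventuallyEq
      (by filter_upwards [isOpen_Ioo.mem_nhds ht] with τ hτ using (hd τ hτ).deriv)
  have hT := hh₀.integrable_slopeRatio hh₁ hR ht
  have hae := AggDiff.convexityIntegrand_ae_eq hρ₀ hρ₁ t
  refine ⟨(hd t ht).differentiableAt, hd2.differentiableAt, ?_, ?_⟩
  · rw [intervalIntegrable_iff_integrableOn_Ioo_of_le zero_le_one]
    exact hT.congr hae.symm
  · rw [hd2.deriv, intervalIntegral.integral_of_le zero_le_one, integral_Ioc_eq_integral_Ioo,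
      integral_congr_ae hae]
    have h1 := hh₀.integral_powerIntegrandD2_nonneg hh₁ hR hm ht
    have h2 := hh₀.le_integral_pairIntegrandD2 hh₁ hR hB hl ht
    have hT0 : 0 ≤ ∫ s, AggDiff.slopeRatio (AggDiff.hFun ρ₀) (AggDiff.hFun ρ₁) t s
        ∂AggDiff.unitVolume :=
      integral_nonneg fun s => div_nonneg (sq_nonneg _) (even_two_mul 2 |>.pow_nonneg _)
    have h3 : 0 ≤ m / (m - 1) := div_nonneg (by linarith) (by linarith)
    have h4 := mul_nonneg h3 h1
    have h5 : 0 ≤ AggDiff.powerProfile cα α (2 * R) / R := div_nonneg hl hR.le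
    have h6 := mul_nonneg h5 hT0
    have e : AggDiff.powerProfile cα α (2 * R) / (3 * R) =
        1 / 3 * (AggDiff.powerProfile cα α (2 * R) / R) := by field_simp
    rw [e] at h2
    -- Half of the constant `1/3` in `h2` exceeds the required `1/32`.
    linarith
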